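/- A pinwheel instance is an $m$-tuple $A=(a_1,\dots,a_m)$ of real periods $a_i\ge 1$. A schedule is a map $\sigma:\mathbb Z\to\{1,\dots,m\}\cup\{\bot\}$ (times $t$ with $\sigma(t)=\bot$ are holidays). It is valid for $A$ if for every $i$ and every $L$, each interval of $L$ consecutive integers contains at least $\lfloor L/a_i\rfloor$ times $t$ with $\sigma(t)=i$. $A$ is schedulable if it has a valid schedule. The density of $A$, or of a sublist of its periods, is $D(A)=\sum_i 1/a_i$. For $0<\epsilon<2/7$ let $\mathrm{Alg}_\epsilon$ be the following algorithm, whose input is a tuple $A=(a_1,\dots,a_m)$ of positive integers. 1. Put $n=\lceil 1/\epsilon\rceil$. If $D(A)>1$, answer "$A$ is unschedulable". 2. Put $\ell=n$ and $u=16n^2\ell^\ell$. While the periods $j$ of $A$ with $\ell<j<u$ have total density greater than $\frac1{2(n+1)}$, replace $\ell$ by $u$ and then $u$ by $16n^2\ell^\ell$ (with the new $\ell$). 3. Let $A_{\mathrm{big}}$ be the list of the periods of $A$ that are at most $\ell$, and $A_{\mathrm{not\,big}}$ the list of the others. Put $h_{\max}=-1$. For each $p=1,2,\dots,\ell^\ell$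 enumerate all words of length $p$ in the tasks of $A_{\mathrm{big}}$ and $\bot$; for each word whose $p$-periodic repetition is a valid schedule of $A_{\mathrm{big}}$, replace $h_{\max}$ by the maximum of $h_{\max}$ and the fraction of holidays in the word. 4. If $h_{\max}<D(A_{\mathrm{not\,big}})$, answer "$A$ is unschedulable"; otherwise answer "$(1+\epsilon)\cdot A$ is schedulable", where $(1+\epsilon)\cdot A=((1+\epsilon)a_1,\dots,(1+\epsilon)a_m)$. Steps are counted in the unit-cost model: each arithmetic operation on numbers, comparison, list-cell construction and procedure call costs one step. **Theorem.** There is an absolute constant $K$ such that the following holds. (a) For every real $\epsilon\in(0,2/7)$, every $m\ge 0$ and every $m$-tuple $A$ of positive integers, $\mathrm{Alg}_\epsilon$ halts on $A$ after at most $K\cdot\bigl(2\uparrow\uparrow K\lceil 1/\epsilon\rceil\bigr)\cdot(m+1)$ steps; if it answers "$A$ is unschedulable" then $A$ is unschedulable, and if it answers "$(1+\epsilon)\cdot A$ is schedulable" then $(1+\epsilon)\cdot A$ is schedulable. Here $2\uparrow\uparrow 0=1$ and $2\uparrow\uparrow(k+1)=2^{2\uparrow\uparrow k}$. (b) For every real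 $\epsilon\ge 2/7$, every $m\ge0$ and every $m$-tuple $A$ of positive integers, $\mathrm{Alg}_{1/4}$ halts on $A$ after at most $K(m+1)$ steps; if it answers "$A$ is unschedulable" then $A$ is unschedulable, and if it gives the other answer then $(1+\epsilon)\cdot A$ is schedulable. In particular, for every fixed $\epsilon>0$ the $(1+\epsilon)$-approximate pinwheel problem is solved in $O_\epsilon(m)$ steps: the scheme is an EPTAS. -/

import Mathlib

/-! ### Pinwheel scheduling -/

/-- A schedule for the task set `ι`: `σ t = some i` means that task `i` is scheduled at time `t`,
and `σ t = none` means that time step `t` is a holiday. -/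
abbrev Schedule (ι : Type*) := ℤ → Option ι

/-- The schedule `σ` is valid for the (possibly fractional) periods `a` if every interval of `L`
consecutive integers contains at least `⌊L / a i⌋` time steps at which task `i` is scheduled. -/
def Schedule.IsValid {ι : Type*} [DecidableEq ι] (a : ι → ℝ) (σ : Schedule ι) : Prop :=
  ∀ (i : ι) (t : ℤ) (L : ℕ),
    ⌊(L : ℝ) / a i⌋₊ ≤ ((Finset.Ico t (t + L)).filter (fun s => σ s = some i)).card

/-- A pinwheel instance is schedulable if it has a valid schedule. -/
def Schedulable {ι : Type*} [DecidableEq ι] (a : ι → ℝ) : Prop :=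
  ∃ σ : Schedule ι, σ.IsValid a

/-! ### Counting elementary operations

Unit-cost model: one step for each arithmetic operation on, or comparison of, numbers, for each
construction of a list cell, and for each call of a procedure together with the case
distinction on the list or counter that it is called with. -/

/-- The outcome of a computation, together with the number of steps it took. -/
structure Timed (α : Type) where
  val : α
  steps : ℕ

namespace Timed

/-- Run `x`, then `f` on its outcome; the continuation may use that its argument is the outcome
of `x`. -/
def bindEq {α β : Type} (x : Timed α) (f : (a : α) → a = x.val → Timed β) : Timed β :=
  ⟨(f x.val rfl).val, x.steps + (f x.val rfl).steps⟩

instance : Monad Timed where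
  pure a := ⟨a, 0⟩
  bind x f := ⟨(f x.val).val, x.steps + (f x.val).steps⟩

end Timed

/-- One elementary operation with outcome `a`. -/
def op {α : Type} (a : α) : Timed α := ⟨a, 1⟩

/-- The cost of one procedure call. -/
def call : Timed Unit := ⟨(), 1⟩

/-! ### Basic procedures -/

/-- The sum of the reciprocals of the entries. -/
def density : List ℕ → Timed ℚ
  | [] => do
    call
    op 0
  | a :: A => do
    call
    let d ← density A
    let r ← op (1 / (a : ℚ))
    op (r + d)

/-- The sublist of the entries that pass the test. -/
def select (test : ℕ → Timed Bool) : List ℕ → Timed (List ℕ)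
  | [] => do
    call
    op []
  | a :: A => do
    call
    let B ← select test A
    let b ← test a
    if b then op (a :: B) else pure B

/-- The length of a list. -/
def len : List ℕ → Timed ℕ
  | [] => do
    call
    op 0
  | _ :: A => do
    call
    let k ← len A
    op (k + 1)

/-- `power b k` computes `b ^ k` by repeated multiplication. -/
def power (b : ℕ) : ℕ → Timed ℕ
  | 0 => do
    call
    op 1
  | k + 1 => do
    call
    let x ← power b k
    op (x * b)

/-! ### The cutoff between big, medium and small tasks -/

/-- `nextCutoff n ℓ` computes `u = 16 n² ℓ ^ ℓ`. -/
def nextCutoff (n ℓ : ℕ) : Timed ℕ := do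
  call
  let x ← power ℓ ℓ
  let y ← op (n * n)
  let z ← op (16 * y)
  op (z * x)

/-- Test for `ℓ < j < u`. -/
def isMedium (ℓ u j : ℕ) : Timed Bool := do
  call
  let b ← op (decide (ℓ < j))
  if b then op (decide (j < u)) else pure false

/-- The density of the periods strictly between `ℓ` and `u`. -/
def mediumDensity (A : List ℕ) (ℓ u : ℕ) : Timed ℚ := do
  call
  let B ← select (isMedium ℓ u) A
  density B

/-- `1 / (2 (n + 1))` -/
def threshold (n : ℕ) : Timed ℚ := do
  call
  let x ← op (n + 1)
  let y ← op (2 * x)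
  op (1 / (y : ℚ))

theorem exists_between_of_mediumDensity_pos (A : List ℕ) (ℓ u : ℕ)
    (h : 0 < (mediumDensity A ℓ u).val) : ∃ j ∈ A, ℓ < j ∧ j < u := by
  by_contra hcon
  push Not at hcon
  have key : ∀ B : List ℕ, (∀ j ∈ B, ℓ < j → u ≤ j) → (select (isMedium ℓ u) B).val = [] := by
    intro B
    induction B with
    | nil => intro _; rfl
    | cons a B ih =>
      intro hB
      have h1 := ih (fun j hj => hB j (List.mem_cons_of_mem _ hj))
      have h2 : (isMedium ℓ u a).val = false := by
        have h3 := hB a List.mem_cons_self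
        by_cases h4 : ℓ < a
        · have h5 : ¬ a < u := not_lt.mpr (h3 h4)
          simp [isMedium, bind, op, h4, h5]
        · simp [isMedium, bind, op, h4, pure]
      simp only [select, bind, h2, pure]
      simpa using h1
  have h0 : (mediumDensity A ℓ u).val = 0 := by
    simp only [mediumDensity, bind, key A hcon]
    rfl
  rw [h0] at h
  exact lt_irrefl _ h

/-- The loop that raises `ℓ` and `u` until the periods strictly between them have density at most
`1 / (2 (n + 1))`; the outcome is the final value of `ℓ`. -/
def cutoffLoop (A : List ℕ) (n ℓ u : ℕ) : Timed ℕ :=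
  call.bindEq fun _ _ =>
  (mediumDensity A ℓ u).bindEq fun d _hd =>
  (threshold n).bindEq fun θ _hθ =>
  (op (decide (d ≤ θ))).bindEq fun b _hb =>
  if _hle : b = true then pure ℓ
  else
    (nextCutoff n u).bindEq fun u' _ => cutoffLoop A n u u'
termination_by (A.filter (fun j => ℓ < j)).length
decreasing_by
  subst _hd _hθ _hb
  have hlt : (threshold n).val < (mediumDensity A ℓ u).val := by
    simpa [op] using _hle
  have hnn : (0 : ℚ) ≤ (threshold n).val := by
    simp only [threshold, bind, op]
    positivity
  obtain ⟨j, hjA, hj1, hj2⟩ :=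
    exists_between_of_mediumDensity_pos A ℓ u (lt_of_le_of_lt hnn hlt)
  have e : A.filter (fun j => u < j) = (A.filter (fun j => ℓ < j)).filter (fun j => u < j) := by
    rw [List.filter_filter]
    apply List.filter_congr
    intro x _
    have : u < x → ℓ < x := fun h => by omega
    by_cases hx : u < x
    · simp [hx, this hx]
    · simp [hx]
  rw [e]
  refine List.length_filter_lt_length_iff_exists.mpr ⟨j, ?_, ?_⟩
  · simp [hjA, hj1]
  · simp; omega

/-! ### Enumeration of the periodic schedules of the big tasks

One period of a periodic schedule of `k` tasks is a word over the letters `0, …, k`; the letter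
`0` is a holiday and the letter `c + 1` is the `c`-th task of the list. -/

/-- Add the words `c :: w`, `c < k`, to the list `W`. -/
def addExtensions (w : List ℕ) : ℕ → List (List ℕ) → Timed (List (List ℕ))
  | 0, W => do
    call
    pure W
  | c + 1, W => do
    call
    let v ← op (c :: w)
    let W' ← op (v :: W)
    addExtensions w c W'

/-- All one-letter extensions, by letters `c < k`, of the words in a list. -/
def extendAll (k : ℕ) : List (List ℕ) → Timed (List (List ℕ))
  | [] => do
    call
    op []
  | w :: W => do
    call
    let V ← extendAll k W
    addExtensions w k V

/-- All words of length `p` over the letters `0, …, k - 1`. -/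
def allWords (k : ℕ) : ℕ → Timed (List (List ℕ))
  | 0 => do
    call
    op [[]]
  | p + 1 => do
    call
    let W ← allWords k p
    extendAll k W

/-- If the letter `c` was last seen `g` days before the word, `daysSince c g w` is the number of
days since it was last seen at the end of `w`. -/
def daysSince (c : ℕ) : ℕ → List ℕ → Timed ℕ
  | g, [] => do
    call
    pure g
  | g, x :: w => do
    call
    let b ← op (decide (x = c))
    if b then daysSince c 0 w
    else do
      let g' ← op (g + 1)
      daysSince c g' w

/-- Reading the word after `g` days without the letter `c`, there are never `a` consecutive days
without it. -/
def neverLate (a c : ℕ) : ℕ → List ℕ → Timed Bool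
  | _, [] => do
    call
    pure true
  | g, x :: w => do
    call
    let b ← op (decide (x = c))
    if b then neverLate a c 0 w
    else do
      let g' ← op (g + 1)
      let late ← op (decide (a ≤ g'))
      if late then pure false else neverLate a c g' w

/-- In the periodic repetition of the non-empty word `w`, any `a` consecutive days contain the
letter `c`. The first pass determines how long ago `c` was last seen when a period begins (at
least `a` days ago if it does not occur at all), the second pass checks the period. -/
def taskValid (w : List ℕ) (a c : ℕ) : Timed Bool := do
  call
  let g ← daysSince c a w
  neverLate a c g w

/-- `taskValid` for all tasks of a list of periods, the letter of the first one being `c`. -/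
def allValid (w : List ℕ) : ℕ → List ℕ → Timed Bool
  | _, [] => do
    call
    pure true
  | c, a :: B => do
    call
    let b ← taskValid w a c
    if b then do
      let c' ← op (c + 1)
      allValid w c' B
    else pure false

/-- The number of holidays in a word. -/
def holidays : List ℕ → Timed ℕ
  | [] => do
    call
    op 0
  | x :: w => do
    call
    let z ← holidays w
    let b ← op (decide (x = 0))
    if b then op (z + 1) else pure z

/-- The maximum of `h` and the holiday fractions of those words of length `p` in a list whose
periodic repetition is a valid schedule of `big`. -/
def maxHoliday (big : List ℕ) (p : ℕ) : List (List ℕ) → ℚ → Timed ℚ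
  | [], h => do
    call
    pure h
  | w :: W, h => do
    call
    let b ← allValid w 1 big
    if b then do
      let z ← holidays w
      let f ← op ((z : ℚ) / (p : ℚ))
      let h' ← op (max h f)
      maxHoliday big p W h'
    else maxHoliday big p W h

/-- `periodLoop big k r p h` is the maximum of `h` and the holiday fractions of the valid
`q`-periodic schedules of `big`, `p ≤ q < p + r`, where `k` is the number of letters. -/
def periodLoop (big : List ℕ) (k : ℕ) : ℕ → ℕ → ℚ → Timed ℚ
  | 0, _, h => do
    call
    pure h
  | r + 1, p, h => do
    call
    let W ← allWords k p
    let h' ← maxHoliday big p W h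
    let p' ← op (p + 1)
    periodLoop big k r p' h'

/-! ### The approximation scheme -/

/-- The two possible answers on input `A`. -/
inductive Verdict
  /-- "`A` is unschedulable" -/
  | unschedulable
  /-- "`(1 + ε) · A` is schedulable" -/
  | scaledSchedulable

/-- The approximation scheme for pinwheel scheduling, on input `A` with parameter `ε`.
The running maximum of the holiday fractions starts at `-1`, so that it stays negative
if the big tasks have no valid schedule at all. -/
noncomputable def pinwheelPTAS (ε : ℝ) (A : List ℕ) : Timed Verdict := do
  call
  let x ← op (1 / ε)
  let n ← op ⌈x⌉₊
  let d ← density A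
  let tooDense ← op (decide (1 < d))
  if tooDense then pure Verdict.unschedulable
  else do
    let u ← nextCutoff n n
    let ℓ ← cutoffLoop A n n u
    let big ← select (fun j => op (decide (j ≤ ℓ))) A
    let k ← len big
    let k' ← op (k + 1)
    let N ← power ℓ ℓ
    let hmax ← periodLoop big k' N 1 (-1)
    let notBig ← select (fun j => op (decide (ℓ < j))) A
    let dn ← density notBig
    let b ← op (decide (hmax < dn))
    if b then pure Verdict.unschedulable
    else pure Verdict.scaledSchedulable

/-- The algorithm `alg` solves the `α`-approximate pinwheel problem on all `m`-tuples of positive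
integers, with correct answers and in at most `T m` steps. -/
def SolvesApproxPinwheel (α : ℝ) (alg : List ℕ → Timed Verdict) (T : ℕ → ℕ) : Prop :=
  ∀ (m : ℕ) (A : Fin m → ℕ), (∀ i, 1 ≤ A i) →
    ((alg (List.ofFn A)).val = Verdict.unschedulable →
      ¬ Schedulable (fun i => (A i : ℝ))) ∧
    ((alg (List.ofFn A)).val = Verdict.scaledSchedulable →
      Schedulable (fun i => α * (A i : ℝ))) ∧
    (alg (List.ofFn A)).steps ≤ T m

/-- The tower function `2 ↑↑ k`. -/
def tower : ℕ → ℕ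
  | 0 => 1
  | k + 1 => 2 ^ tower k

/-! The big tasks form a finite system. While a schedule is valid, the number of days since the last
execution of each big task stays below its period. Density at most 1 leaves room for at most `ℓ` big
tasks, so these age vectors take at most `N = ℓ ^ ℓ` values, and a schedule traces a walk through
them. A walk longer than `N` contains a closed piece of length at most `N`, which can be cut out
(`exists_closed_subwalk`). So, up to a bounded error, no walk has a larger holiday fraction than the
best periodic schedule of period at most `N` (`count_le_of_isWalk`). A valid schedule of `A` runs
all other tasks during holidays of the big ones, so their density cannot exceed that fraction; this
justifies the negative answer (`le_periodLoop_of_schedulable`).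

For the positive answer, insert one slot before every `n` days of the best periodic schedule. This
stretches the big periods by `1 + 1 / n ≤ 1 + ε` and adds free slots of density `1 / (n + 1)` to the
old holidays. The other tasks become unit jobs with interval windows, and Hall's condition for such
jobs need only be checked on intervals (`exists_assignment`). Medium tasks get windows of half their
stretched period, hence twice their density, which the inserted slots alone can carry. Small tasks
are rounded to a geometric scale and staggered within each class. Their windows are so long that all
rounding errors fit into what is left of the inserted slots (`demand_le_supply`,
`exists_assignment_of_density`).

For the running time, each raise of the cutoff uses up density more than `1 / (2 (n + 1))`, so there
are at most `2 (n + 1)` raises, each worth three levels of the tower (`cutoffLoop_spec`). The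
enumeration depends on `ℓ` only and costs at most `N ^ (N + 4)`; the rest is linear in the number of
tasks. -/

namespace Timed

variable {α β : Type}

@[simp] theorem val_bind (x : Timed α) (f : α → Timed β) : (x >>= f).val = (f x.val).val := rfl

@[simp] theorem steps_bind (x : Timed α) (f : α → Timed β) :
    (x >>= f).steps = x.steps + (f x.val).steps := rfl

@[simp] theorem val_pure (a : α) : (pure a : Timed α).val = a := rfl

@[simp] theorem steps_pure (a : α) : (pure a : Timed α).steps = 0 := rfl

@[simp] theorem val_ite (p : Prop) [Decidable p] (x y : Timed α) :
    (if p then x else y).val = if p then x.val else y.val := by split_ifs <;> rfl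

@[simp] theorem steps_ite (p : Prop) [Decidable p] (x y : Timed α) :
    (if p then x else y).steps = if p then x.steps else y.steps := by split_ifs <;> rfl

end Timed

@[simp] theorem val_op {α : Type} (a : α) : (op a).val = a := rfl

@[simp] theorem steps_op {α : Type} (a : α) : (op a).steps = 1 := rfl

@[simp] theorem steps_call : call.steps = 1 := rfl

/-! ### Outcomes and costs of the basic procedures -/

/-- The density of a list of periods. -/
def recipSum (A : List ℕ) : ℚ := (A.map fun a : ℕ => 1 / (a : ℚ)).sum

@[simp] theorem recipSum_nil : recipSum [] = 0 := rfl

@[simp] theorem recipSum_cons (a : ℕ) (A : List ℕ) :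
    recipSum (a :: A) = 1 / (a : ℚ) + recipSum A := by simp [recipSum]

theorem recipSum_nonneg (A : List ℕ) : 0 ≤ recipSum A :=
  List.sum_nonneg fun x hx => by
    obtain ⟨a, -, rfl⟩ := List.mem_map.1 hx
    exact one_div_nonneg.2 (Nat.cast_nonneg a)

theorem val_density (A : List ℕ) : (density A).val = recipSum A := by
  induction A with
  | nil => simp [density]
  | cons a A ih => simp [density, ih]

theorem steps_density (A : List ℕ) : (density A).steps = 3 * A.length + 2 := by
  induction A with
  | nil => simp [density]
  | cons a A ih => simp [density, ih]; ring

theorem val_select (test : ℕ → Timed Bool) (A : List ℕ) :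
    (select test A).val = A.filter fun a => (test a).val := by
  induction A with
  | nil => simp [select]
  | cons a A ih => simp [select, ih, List.filter_cons]

theorem steps_select_le (test : ℕ → Timed Bool) (C : ℕ) (h : ∀ a, (test a).steps ≤ C)
    (A : List ℕ) : (select test A).steps ≤ (C + 2) * A.length + 2 := by
  induction A with
  | nil => simp [select]
  | cons a A ih =>
    have := h a
    simp only [select, Timed.steps_bind, steps_call, Timed.steps_ite, steps_op, Timed.steps_pure,
      List.length_cons, mul_add]
    split_ifs <;> linarith

theorem val_len (A : List ℕ) : (len A).val = A.length := by
  induction A with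
  | nil => simp [len]
  | cons a A ih => simp [len, ih]

theorem steps_len (A : List ℕ) : (len A).steps = 2 * A.length + 2 := by
  induction A with
  | nil => simp [len]
  | cons a A ih => simp [len, ih]; ring

theorem val_power (b k : ℕ) : (power b k).val = b ^ k := by
  induction k with
  | zero => simp [power]
  | succ k ih => simp [power, ih, pow_succ]

theorem steps_power (b k : ℕ) : (power b k).steps = 2 * k + 2 := by
  induction k with
  | zero => simp [power]
  | succ k ih => simp [power, ih]; ring

theorem val_nextCutoff (n l : ℕ) : (nextCutoff n l).val = 16 * n ^ 2 * l ^ l := by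
  simp [nextCutoff, val_power, sq]

theorem steps_nextCutoff (n l : ℕ) : (nextCutoff n l).steps = 2 * l + 6 := by
  simp [nextCutoff, steps_power]; ring

theorem val_isMedium (l u j : ℕ) : (isMedium l u j).val = decide (l < j ∧ j < u) := by
  by_cases h : l < j <;> simp [isMedium, h]

theorem steps_isMedium_le (l u j : ℕ) : (isMedium l u j).steps ≤ 3 := by
  by_cases h : l < j <;> simp [isMedium, h]

theorem val_mediumDensity (A : List ℕ) (l u : ℕ) :
    (mediumDensity A l u).val = recipSum (A.filter fun j => l < j ∧ j < u) := by
  simp [mediumDensity, val_select, val_density, val_isMedium]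

theorem steps_mediumDensity_le (A : List ℕ) (l u : ℕ) :
    (mediumDensity A l u).steps ≤ 8 * A.length + 5 := by
  have h1 := steps_select_le (isMedium l u) 3 (steps_isMedium_le l u) A
  have h2 := List.length_filter_le (fun a => (isMedium l u a).val) A
  simp only [mediumDensity, Timed.steps_bind, steps_call, steps_density, val_select]
  omega

theorem val_threshold (n : ℕ) : (threshold n).val = 1 / (2 * (n + 1)) := by
  simp [threshold]

theorem steps_threshold (n : ℕ) : (threshold n).steps = 4 := by
  simp [threshold]

/-! ### Costs and outcomes of the enumeration -/

theorem addExtensions_spec (w : List ℕ) (c : ℕ) (W : List (List ℕ)) :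
    (addExtensions w c W).steps = 3 * c + 1 ∧
      (addExtensions w c W).val.length = W.length + c ∧
      ∀ v, v ∈ (addExtensions w c W).val ↔ v ∈ W ∨ ∃ d < c, v = d :: w := by
  induction c generalizing W with
  | zero => simp [addExtensions]
  | succ c ih =>
    obtain ⟨h1, h2, h3⟩ := ih ((c :: w) :: W)
    refine ⟨?_, ?_, fun v => ?_⟩
    · simp [addExtensions, h1]; ring
    · simp [addExtensions, h2]; ring
    · simp only [addExtensions, Timed.val_bind, val_op, h3, List.mem_cons,
        Order.lt_add_one_iff, le_iff_lt_or_eq]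
      grind

theorem extendAll_spec (k : ℕ) (W : List (List ℕ)) :
    (extendAll k W).steps = W.length * (3 * k + 2) + 2 ∧
      (extendAll k W).val.length = k * W.length ∧
      ∀ v, v ∈ (extendAll k W).val ↔ ∃ d < k, ∃ w ∈ W, v = d :: w := by
  induction W with
  | nil => simp [extendAll]
  | cons w W ih =>
    obtain ⟨h1, h2, h3⟩ := ih
    obtain ⟨g1, g2, g3⟩ := addExtensions_spec w k (extendAll k W).val
    refine ⟨?_, ?_, fun v => ?_⟩
    · simp [extendAll, h1, g1]; ring
    · simp [extendAll, h2, g2]; ring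
    · simp only [extendAll, Timed.val_bind, g3, h3, List.mem_cons]
      constructor
      · rintro (⟨d, hd, w', hw', rfl⟩ | ⟨d, hd, rfl⟩)
        exacts [⟨d, hd, w', .inr hw', rfl⟩, ⟨d, hd, w, .inl rfl, rfl⟩]
      · rintro ⟨d, hd, w', rfl | hw', rfl⟩
        exacts [.inr ⟨d, hd, rfl⟩, .inl ⟨d, hd, w', hw', rfl⟩]

theorem allWords_spec (k : ℕ) (hk : 1 ≤ k) (p : ℕ) :
    (allWords k p).steps ≤ (p + 1) * (k ^ p * (3 * k + 5)) ∧
      (allWords k p).val.length = k ^ p ∧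
      ∀ v, v ∈ (allWords k p).val ↔ v.length = p ∧ ∀ c ∈ v, c < k := by
  induction p with
  | zero => simp [allWords]
  | succ p ih =>
    obtain ⟨h1, h2, h3⟩ := ih
    obtain ⟨g1, g2, g3⟩ := extendAll_spec k (allWords k p).val
    refine ⟨?_, ?_, fun v => ?_⟩
    · have e1 : 1 ≤ k ^ p := Nat.one_le_pow _ _ hk
      have e2 : k ^ p ≤ k ^ (p + 1) := Nat.pow_le_pow_right hk (by omega)
      simp only [allWords, Timed.steps_bind, steps_call, g1, h2]
      calc 1 + ((allWords k p).steps + (k ^ p * (3 * k + 2) + 2))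
          ≤ (p + 1) * (k ^ p * (3 * k + 5)) + k ^ p * (3 * k + 5) := by nlinarith
        _ = (p + 2) * (k ^ p * (3 * k + 5)) := by ring
        _ ≤ _ := by gcongr
    · simp [allWords, g2, h2, pow_succ']
    · simp only [allWords, Timed.val_bind, g3, h3]
      constructor
      · rintro ⟨d, hd, w, ⟨hw, hw'⟩, rfl⟩
        simpa [hw, hd] using hw'
      · rintro ⟨h, h'⟩
        cases v with
        | nil => simp at h
        | cons d w =>
          exact ⟨d, h' d (by simp), w, ⟨by simpa using h, fun c hc => h' c (by simp [hc])⟩, rfl⟩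

theorem steps_daysSince_le (c g : ℕ) (w : List ℕ) :
    (daysSince c g w).steps ≤ 3 * w.length + 1 := by
  induction w generalizing g with
  | nil => simp [daysSince]
  | cons x w ih =>
    have h1 := ih 0
    have h2 := ih (g + 1)
    by_cases h : x = c <;> simp [daysSince, h] <;> omega

theorem steps_neverLate_le (a c g : ℕ) (w : List ℕ) :
    (neverLate a c g w).steps ≤ 4 * w.length + 1 := by
  induction w generalizing g with
  | nil => simp [neverLate]
  | cons x w ih =>
    have h1 := ih 0
    have h2 := ih (g + 1)
    by_cases h : x = c
    · simp [neverLate, h]; omega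
    · by_cases h' : a ≤ g + 1 <;> simp [neverLate, h, h'] <;> omega

theorem steps_taskValid_le (w : List ℕ) (a c : ℕ) :
    (taskValid w a c).steps ≤ 7 * w.length + 3 := by
  have h1 := steps_daysSince_le c a w
  have h2 := steps_neverLate_le a c (daysSince c a w).val w
  simp only [taskValid, Timed.steps_bind, steps_call]
  omega

theorem steps_allValid_le (w : List ℕ) (c : ℕ) (B : List ℕ) :
    (allValid w c B).steps ≤ (7 * w.length + 5) * B.length + 1 := by
  induction B generalizing c with
  | nil => simp [allValid]
  | cons a B ih =>
    have h1 := ih (c + 1)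
    have h2 := steps_taskValid_le w a c
    by_cases h : (taskValid w a c).val = true <;> simp [allValid, h, mul_add] <;> nlinarith

theorem val_holidays (w : List ℕ) : (holidays w).val = w.count 0 := by
  induction w with
  | nil => simp [holidays]
  | cons x w ih => by_cases h : x = 0 <;> simp [holidays, ih, h]

theorem steps_holidays_le (w : List ℕ) : (holidays w).steps ≤ 3 * w.length + 2 := by
  induction w with
  | nil => simp [holidays]
  | cons x w ih => by_cases h : x = 0 <;> simp [holidays, h] <;> omega

theorem steps_maxHoliday_le (big : List ℕ) (p : ℕ) (W : List (List ℕ)) (h : ℚ)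
    (hW : ∀ w ∈ W, w.length = p) :
    (maxHoliday big p W h).steps ≤
      W.length * ((7 * p + 5) * big.length + 3 * p + 6) + 1 := by
  induction W generalizing h with
  | nil => simp [maxHoliday]
  | cons w W ih =>
    have hp := hW w (by simp)
    have h1 := steps_allValid_le w 1 big
    have h2 := steps_holidays_le w
    rw [hp] at h1 h2
    have ih' := fun h => ih h fun v hv => hW v (by simp [hv])
    by_cases hv : (allValid w 1 big).val = true
    · have := ih' (max h (((holidays w).val : ℚ) / p))
      simp only [maxHoliday, Timed.steps_bind, steps_call, hv, if_true, val_op, steps_op,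
        List.length_cons]
      linarith
    · have := ih' h
      simp only [maxHoliday, Timed.steps_bind, steps_call, hv, List.length_cons]
      simp only [Bool.false_eq_true, if_false]
      linarith

/-- Describing the maximum by its lower bounds serves both answers: a valid word gives a lower bound
on the outcome, and a lower bound above the starting value gives back a valid word. -/
theorem le_maxHoliday_iff (big : List ℕ) (p : ℕ) (W : List (List ℕ)) (h x : ℚ) :
    x ≤ (maxHoliday big p W h).val ↔
      x ≤ h ∨ ∃ w ∈ W, (allValid w 1 big).val = true ∧ x ≤ (w.count 0 : ℚ) / p := by
  induction W generalizing h with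
  | nil => simp [maxHoliday]
  | cons w W ih =>
    by_cases hv : (allValid w 1 big).val = true
    · simp [maxHoliday, hv, ih, val_holidays, or_assoc]
    · simp [maxHoliday, hv, ih]

theorem steps_periodLoop_le (big : List ℕ) (k : ℕ) (hk : 1 ≤ k) (N r p : ℕ) (h : ℚ)
    (hr : p + r ≤ N + 1) :
    (periodLoop big k r p h).steps ≤
      r * (3 + (N + 1) * (k ^ N * (3 * k + 5)) +
        k ^ N * ((7 * N + 5) * big.length + 3 * N + 6)) + 1 := by
  induction r generalizing p h with
  | zero => simp [periodLoop]
  | succ r ih =>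
    obtain ⟨h1, h2, h3⟩ := allWords_spec k hk p
    have h4 := steps_maxHoliday_le big p (allWords k p).val h fun w hw => ((h3 w).1 hw).1
    rw [h2] at h4
    have h5 := ih (p + 1) (maxHoliday big p (allWords k p).val h).val (by omega)
    have hp : p ≤ N := by omega
    have h6 : (p + 1) * (k ^ p * (3 * k + 5)) ≤ (N + 1) * (k ^ N * (3 * k + 5)) := by gcongr
    have h7 : k ^ p * ((7 * p + 5) * big.length + 3 * p + 6) ≤
        k ^ N * ((7 * N + 5) * big.length + 3 * N + 6) := by gcongr
    simp only [periodLoop, Timed.steps_bind, steps_call, val_op, steps_op, add_mul, one_mul]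
    simp only [add_mul] at h5 h6 h7 h4
    linarith

theorem le_periodLoop_iff (big : List ℕ) (k : ℕ) (hk : 1 ≤ k) (r p : ℕ) (h x : ℚ) :
    x ≤ (periodLoop big k r p h).val ↔
      x ≤ h ∨ ∃ w : List ℕ, p ≤ w.length ∧ w.length < p + r ∧ (∀ c ∈ w, c < k) ∧
        (allValid w 1 big).val = true ∧ x ≤ (w.count 0 : ℚ) / w.length := by
  induction r generalizing p h with
  | zero => simp [periodLoop]; grind
  | succ r ih =>
    obtain ⟨-, -, h3⟩ := allWords_spec k hk p
    simp only [periodLoop, Timed.val_bind, val_op, ih, le_maxHoliday_iff, h3, or_assoc]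
    refine or_congr_right ⟨?_, ?_⟩
    · rintro (⟨w, ⟨rfl, hw⟩, hv, hx⟩ | ⟨w, h1, h2, hw, hv, hx⟩)
      · exact ⟨w, le_rfl, by omega, hw, hv, hx⟩
      · exact ⟨w, by omega, by omega, hw, hv, hx⟩
    · rintro ⟨w, h1, h2, hw, hv, hx⟩
      rcases h1.eq_or_lt with h1 | h1
      · exact .inl ⟨w, ⟨h1.symm, hw⟩, hv, h1 ▸ hx⟩
      · exact .inr ⟨w, by omega, by omega, hw, hv, hx⟩

/-! ### The cutoff loop -/

/-- The two sublists on the left are disjoint. Only an inequality, because a period equal to `u` is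
counted in neither; it becomes big once `u` is the cutoff. -/
theorem recipSum_filter_add_le (A : List ℕ) {l u : ℕ} (hlu : l ≤ u) :
    recipSum (A.filter fun j => l < j ∧ j < u) + recipSum (A.filter fun j => u < j) ≤
      recipSum (A.filter fun j => l < j) := by
  induction A with
  | nil => simp
  | cons a A ih =>
    have ha : (0 : ℚ) ≤ (a : ℚ)⁻¹ := by positivity
    by_cases h1 : l < a
    · by_cases h2 : a < u
      · have h3 : ¬ u < a := by omega
        simp [h1, h2, h3] at ih ⊢; linarith
      · by_cases h3 : u < a <;> simp [h1, h2, h3] at ih ⊢ <;> linarith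
    · have h3 : ¬ u < a := by omega
      simp [h1, h3] at ih ⊢; linarith

theorem recipSum_filter_add_filter_not (A : List ℕ) (P : ℕ → Prop) [DecidablePred P] :
    recipSum (A.filter fun j => P j) + recipSum (A.filter fun j => ¬ P j) = recipSum A := by
  induction A with
  | nil => simp
  | cons a A ih => by_cases h : P a <;> simp [h] at ih ⊢ <;> linarith

theorem recipSum_filter_le (A : List ℕ) (P : ℕ → Prop) [DecidablePred P] :
    recipSum (A.filter fun j => P j) ≤ recipSum A := by
  rw [← recipSum_filter_add_filter_not A P]
  linarith [recipSum_nonneg (A.filter fun j => ¬ P j)]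

theorem cutoffLoop_of_le {A : List ℕ} {n l u : ℕ}
    (h : (mediumDensity A l u).val ≤ (threshold n).val) :
    (cutoffLoop A n l u).val = l ∧
      (cutoffLoop A n l u).steps = (mediumDensity A l u).steps + 6 := by
  rw [cutoffLoop]
  simp [Timed.bindEq, h, steps_threshold]
  ring

theorem cutoffLoop_of_lt {A : List ℕ} {n l u : ℕ}
    (h : (threshold n).val < (mediumDensity A l u).val) :
    (cutoffLoop A n l u).val = (cutoffLoop A n u (nextCutoff n u).val).val ∧
      (cutoffLoop A n l u).steps = (mediumDensity A l u).steps + 6 + (nextCutoff n u).steps +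
        (cutoffLoop A n u (nextCutoff n u).val).steps := by
  rw [cutoffLoop]
  simp [Timed.bindEq, h.not_ge, steps_threshold]
  ring

/-! ### Growth of the cutoffs along the tower -/

theorem lt_tower (k : ℕ) : k < tower k := by
  induction k with
  | zero => simp [tower]
  | succ k ih => exact lt_of_le_of_lt (Nat.succ_le_of_lt ih) Nat.lt_two_pow_self

theorem tower_strictMono : StrictMono tower :=
  strictMono_nat_of_lt_succ fun _ => Nat.lt_two_pow_self

/-- The exponent `x + 4` covers two uses: a raised cutoff is at most `ℓ ^ (ℓ + 4)`, and the
enumeration costs at most `N ^ (N + 4)`. Either one climbs three levels of the tower. -/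
theorem pow_add_four_le {x : ℕ} (hx : 4 ≤ x) : x ^ (x + 4) ≤ 2 ^ 2 ^ 2 ^ x := by
  have h1 : x < 2 ^ x := Nat.lt_two_pow_self
  have h2 : ∀ y, 4 ≤ y → 2 * y + 1 ≤ 2 ^ y := by
    intro y hy
    induction y, hy using Nat.le_induction with
    | base => norm_num
    | succ y _ ih => rw [pow_succ]; omega
  calc x ^ (x + 4) ≤ (2 ^ x) ^ (x + 4) := by gcongr
    _ = 2 ^ (x * (x + 4)) := by rw [pow_mul]
    _ ≤ 2 ^ (2 ^ (2 * x + 1)) := by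
      gcongr
      · norm_num
      · calc x * (x + 4) ≤ 2 ^ x * (2 * 2 ^ x) := by gcongr; omega
          _ = 2 ^ (2 * x + 1) := by ring
    _ ≤ 2 ^ 2 ^ 2 ^ x := by
      gcongr
      · norm_num
      · norm_num
      · exact h2 x hx

theorem pow_add_four_le_tower {x k : ℕ} (hx : 4 ≤ x) (hk : x ≤ tower k) :
    x ^ (x + 4) ≤ tower (k + 3) := by
  refine (pow_add_four_le hx).trans ?_
  simp only [tower]
  gcongr <;> norm_num

theorem cutoff_le_tower {n l k : ℕ} (hn : 4 ≤ n) (hl : n ≤ l) (hk : l ≤ tower k) :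
    16 * n ^ 2 * l ^ l ≤ tower (k + 3) := by
  refine le_trans ?_ (pow_add_four_le_tower (hn.trans hl) hk)
  calc 16 * n ^ 2 * l ^ l ≤ l ^ 2 * l ^ 2 * l ^ l := by gcongr; nlinarith
    _ = l ^ (l + 4) := by ring

/-- The budget `q` counts the raises that can still occur: the density above the cutoff is at most
`q` thresholds, and every raise removes more than one threshold from it. -/
theorem cutoffLoop_spec {A : List ℕ} {n : ℕ} (hn : 4 ≤ n) (q : ℕ) {l k : ℕ} (hl : n ≤ l)
    (hk : l ≤ tower k) (hA : recipSum (A.filter fun j => l < j) ≤ q / (2 * (n + 1)))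
    {l' : ℕ} (hl' : l' = (cutoffLoop A n l (16 * n ^ 2 * l ^ l)).val) :
    n ≤ l' ∧ l' ≤ tower (k + 3 * q) ∧
      recipSum (A.filter fun j => l' < j ∧ j < 16 * n ^ 2 * l' ^ l') ≤ 1 / (2 * (n + 1)) ∧
      (cutoffLoop A n l (16 * n ^ 2 * l ^ l)).steps ≤
        (q + 1) * (8 * A.length + 17 + 2 * tower (k + 3 * q)) := by
  induction q generalizing l k with
  | zero =>
    -- With no budget left, the medium density is at most zero and the loop stops at once.
    have h0 : (mediumDensity A l (16 * n ^ 2 * l ^ l)).val ≤ (threshold n).val := by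
      have h1 := recipSum_filter_add_le A (show l ≤ 16 * n ^ 2 * l ^ l from
        (Nat.le_self_pow (by omega) l).trans (Nat.le_mul_of_pos_left _ (by positivity)))
      have h2 := recipSum_nonneg (A.filter fun j => 16 * n ^ 2 * l ^ l < j)
      rw [val_mediumDensity, val_threshold]
      have h3 : (0 : ℚ) ≤ 1 / (2 * (n + 1)) := by positivity
      simp only [Nat.cast_zero, zero_div] at hA
      linarith
    obtain ⟨h1, h2⟩ := cutoffLoop_of_le h0
    rw [h1] at hl'
    subst hl'
    have h3 := steps_mediumDensity_le A l' (16 * n ^ 2 * l' ^ l')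
    refine ⟨hl, by simpa using hk, ?_, ?_⟩
    · rwa [val_mediumDensity, val_threshold] at h0
    · rw [h2]; simp; omega
  | succ q ih =>
    have hlu : l ≤ 16 * n ^ 2 * l ^ l :=
      (Nat.le_self_pow (by omega) l).trans (Nat.le_mul_of_pos_left _ (by positivity))
    have h3 := steps_mediumDensity_le A l (16 * n ^ 2 * l ^ l)
    rcases le_or_gt (mediumDensity A l (16 * n ^ 2 * l ^ l)).val (threshold n).val with h0 | h0
    · obtain ⟨h1, h2⟩ := cutoffLoop_of_le h0
      rw [h1] at hl'
      subst hl'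
      refine ⟨hl, hk.trans (tower_strictMono.monotone (by omega)), ?_, ?_⟩
      · rwa [val_mediumDensity, val_threshold] at h0
      · rw [h2]; nlinarith
    · obtain ⟨h1, h2⟩ := cutoffLoop_of_lt h0
      rw [h1, val_nextCutoff] at hl'
      rw [val_nextCutoff, steps_nextCutoff] at h2
      have hu := cutoff_le_tower hn hl hk
      obtain ⟨g1, g2, g3, g4⟩ := ih (hl.trans hlu) hu (by
        rw [val_mediumDensity, val_threshold] at h0
        have := recipSum_filter_add_le A hlu
        have e : ((q + 1 : ℕ) : ℚ) / (2 * (n + 1)) = q / (2 * (n + 1)) + 1 / (2 * (n + 1)) := by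
          push_cast; ring
        rw [e] at hA
        linarith) hl'
      have e : k + 3 + 3 * q = k + 3 * (q + 1) := by ring
      rw [e] at g2 g4
      refine ⟨g1, g2, g3, ?_⟩
      rw [h2]
      have := hu.trans (tower_strictMono.monotone (show k + 3 ≤ k + 3 * (q + 1) by omega))
      calc _ ≤ (8 * A.length + 17 + 2 * tower (k + 3 * (q + 1))) +
            (q + 1) * (8 * A.length + 17 + 2 * tower (k + 3 * (q + 1))) :=
            add_le_add (by omega) g4
        _ = _ := by ring

/-! ### Words as walks through the ages of the tasks -/

theorem daysSince_append (c g : ℕ) (u v : List ℕ) :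
    (daysSince c g (u ++ v)).val = (daysSince c (daysSince c g u).val v).val := by
  induction u generalizing g with
  | nil => simp [daysSince]
  | cons x u ih => by_cases h : x = c <;> simp [daysSince, h, ih]

theorem neverLate_append (a c g : ℕ) (u v : List ℕ) :
    (neverLate a c g (u ++ v)).val = true ↔
      (neverLate a c g u).val = true ∧ (neverLate a c (daysSince c g u).val v).val = true := by
  induction u generalizing g with
  | nil => simp [neverLate, daysSince]
  | cons x u ih =>
    by_cases h : x = c
    · simp [neverLate, daysSince, h, ih]
    · by_cases h' : a ≤ g + 1 <;> simp [neverLate, daysSince, h, h', ih]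

theorem daysSince_of_notMem {c : ℕ} (g : ℕ) {w : List ℕ} (h : c ∉ w) :
    (daysSince c g w).val = g + w.length := by
  induction w generalizing g with
  | nil => simp [daysSince]
  | cons x w ih =>
    simp only [List.mem_cons, not_or] at h
    simp [daysSince, Ne.symm h.1, ih _ h.2]; ring

/-- An occurrence of the letter resets the counter, so the initial age is forgotten. -/
theorem daysSince_of_mem {c : ℕ} (g g' : ℕ) {w : List ℕ} (h : c ∈ w) :
    (daysSince c g w).val = (daysSince c g' w).val := by
  induction w generalizing g g' with
  | nil => simp at h
  | cons x w ih =>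
    by_cases hx : x = c
    · simp [daysSince, hx]
    · have : c ∈ w := by simpa [Ne.symm hx] using h
      simpa [daysSince, hx] using ih _ _ this

theorem add_length_lt_of_neverLate {a c g : ℕ} {w : List ℕ} (hw : w ≠ []) (hc : c ∉ w)
    (h : (neverLate a c g w).val = true) : g + w.length < a := by
  induction w generalizing g with
  | nil => simp at hw
  | cons x w ih =>
    simp only [List.mem_cons, not_or] at hc
    by_cases h' : a ≤ g + 1
    · simp [neverLate, Ne.symm hc.1, h'] at h
    · simp only [neverLate, Timed.val_bind, val_op, Ne.symm hc.1] at h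
      rcases eq_or_ne w [] with rfl | hne
      · simpa using h'
      · have := ih hne hc.2 (by simpa [h'] using h)
        simp only [List.length_cons]; omega

theorem daysSince_lt_of_neverLate {a c g : ℕ} {w : List ℕ} (hg : g < a)
    (h : (neverLate a c g w).val = true) : (daysSince c g w).val < a := by
  induction w generalizing g with
  | nil => simpa [daysSince] using hg
  | cons x w ih =>
    by_cases hx : x = c
    · simp only [neverLate, daysSince, hx] at h ⊢
      exact ih (by omega) (by simpa using h)
    · by_cases h' : a ≤ g + 1
      · simp [neverLate, hx, h'] at h
      · simp only [neverLate, daysSince, Timed.val_bind, val_op, hx] at h ⊢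
        simpa using ih (by omega) (by simpa [h'] using h)

/-- A nonempty closed walk must contain the letter, since otherwise the age would grow by the length
of the word. The final age is then independent of the initial one, so the first pass of `taskValid`,
started from `a`, recovers `g`. -/
theorem taskValid_of_closed {a c g : ℕ} {w : List ℕ} (hw : w ≠ [])
    (h1 : (neverLate a c g w).val = true) (h2 : (daysSince c g w).val = g) :
    (taskValid w a c).val = true := by
  have hc : c ∈ w := by
    by_contra hc
    rw [daysSince_of_notMem g hc] at h2
    have := List.length_pos_iff.2 hw
    omega
  simp only [taskValid, Timed.val_bind]
  rw [daysSince_of_mem a g hc, h2, h1]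

/-- This is why the first pass starts from age `a`: without the letter, the second pass would begin
with an age already past the deadline. -/
theorem mem_of_taskValid {a c : ℕ} {w : List ℕ} (hw : w ≠ [])
    (h : (taskValid w a c).val = true) : c ∈ w := by
  by_contra hc
  simp only [taskValid, Timed.val_bind, daysSince_of_notMem a hc] at h
  have := add_length_lt_of_neverLate hw hc h
  omega

theorem allValid_iff (w : List ℕ) (c : ℕ) (B : List ℕ) :
    (allValid w c B).val = true ↔
      ∀ j (hj : j < B.length), (taskValid w B[j] (c + j)).val = true := by
  induction B generalizing c with
  | nil => simp [allValid]
  | cons a B ih =>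
    by_cases h : (taskValid w a c).val = true
    · simp only [allValid, Timed.val_bind, h, if_true, val_op, ih]
      refine ⟨fun H j hj => ?_, fun H j hj => ?_⟩
      · cases j with
        | zero => simpa using h
        | succ j =>
          have := H j (by simpa using hj)
          simpa [add_assoc, add_comm 1 j] using this
      · have := H (j + 1) (by simpa using hj)
        simpa [add_assoc, add_comm 1 j] using this
    · simp only [allValid, Timed.val_bind, Timed.val_ite, h]
      simp only [Bool.false_eq_true, if_false, Timed.val_pure, false_iff]
      intro H
      exact h (H 0 (by simp))

/-- The letter at time `s` of the periodic repetition of a word. -/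
def letterAt (w : List ℕ) (s : ℤ) : ℕ := w.getD (s % w.length).toNat 0

theorem letterAt_natCast (w : List ℕ) (i : ℕ) : letterAt w i = w.getD (i % w.length) 0 := by
  rw [letterAt]; congr 1

theorem letterAt_emod_add (w : List ℕ) (s t : ℤ) :
    letterAt w (s % w.length + t) = letterAt w (s + t) := by
  simp [letterAt]

theorem exists_letterAt_eq {a c : ℕ} (ha0 : 0 < a) {w : List ℕ} (hw : w ≠ [])
    (h : (taskValid w a c).val = true) (t : ℤ) :
    ∃ s, t ≤ s ∧ s < t + a ∧ letterAt w s = c := by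
  have hc := mem_of_taskValid hw h
  have hp := List.length_pos_iff.2 hw
  have hpz : (0 : ℤ) < w.length := by exact_mod_cast hp
  suffices H : ∃ i : ℕ, i < a ∧ letterAt w (t % w.length + i) = c by
    obtain ⟨i, hi, h⟩ := H
    exact ⟨t + i, by omega, by omega, by rw [← h, letterAt_emod_add]⟩
  obtain ⟨r, hr⟩ : ∃ r : ℕ, t % w.length = r :=
    ⟨_, (Int.toNat_of_nonneg (Int.emod_nonneg _ hpz.ne')).symm⟩
  have hrp : r < w.length := by
    have := Int.emod_lt_of_pos t hpz
    omega
  rw [hr]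
  -- If the period is at most `a`, the window covers a whole period and so every letter. Otherwise
  -- it fits inside two consecutive copies of the word.
  rcases le_or_gt w.length a with ha | ha
  · obtain ⟨j, hj, rfl⟩ := List.getElem_of_mem hc
    rcases le_or_gt r j with hrj | hrj
    · refine ⟨j - r, by omega, ?_⟩
      rw [← Nat.cast_add, letterAt_natCast, show r + (j - r) = j by omega, Nat.mod_eq_of_lt hj]
      simp [hj]
    · refine ⟨j + w.length - r, by omega, ?_⟩
      rw [← Nat.cast_add, letterAt_natCast, show r + (j + w.length - r) = j + w.length by omega,
        Nat.add_mod_right, Nat.mod_eq_of_lt hj]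
      simp [hj]
  · set g := (daysSince c a w).val with hg
    have h1 : (neverLate a c g w).val = true := by simpa [taskValid] using h
    have h2 : (daysSince c g w).val = g := by rw [daysSince_of_mem g a hc]
    -- The age `g` reproduces itself over one period, so the check passes on the second copy as
    -- well.
    have h3 : (neverLate a c g (w ++ w)).val = true := by
      rw [neverLate_append, h2]; exact ⟨h1, h1⟩
    rw [← List.take_append_drop r (w ++ w), neverLate_append] at h3
    have h4 := h3.2
    rw [← List.take_append_drop a ((w ++ w).drop r), neverLate_append] at h4
    have h5 := h4.1
    have hlen : (((w ++ w).drop r).take a).length = a := by simp; omega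
    have hmem : c ∈ ((w ++ w).drop r).take a := by
      by_contra hcon
      have := add_length_lt_of_neverLate (by rw [← List.length_pos_iff]; omega) hcon h5
      omega
    obtain ⟨i, hi, h6⟩ := List.getElem_of_mem hmem
    rw [hlen] at hi
    refine ⟨i, hi, ?_⟩
    rw [← Nat.cast_add, letterAt_natCast, ← h6]
    simp only [List.getElem_take, List.getElem_drop, List.getElem_append]
    split_ifs with h7
    · rw [Nat.mod_eq_of_lt h7]; simp [h7]
    · rw [Nat.mod_eq_sub_mod (by omega), Nat.mod_eq_of_lt (by omega)]
      have : r + i - w.length < w.length := by omega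
      simp [this]

theorem neverLate_map_range' {a c : ℕ} {f : ℕ → ℕ}
    (hf : ∀ t, ∃ s, t ≤ s ∧ s < t + a ∧ f s = c) (M t g : ℕ) (hg : g ≤ t)
    (h : ∀ s, t - g ≤ s → s < t → f s ≠ c) :
    (neverLate a c g ((List.range' t M).map f)).val = true := by
  induction M generalizing t g with
  | zero => simp [neverLate]
  | succ M ih =>
    rw [List.range'_succ, List.map_cons]
    by_cases hc : f t = c
    · simp only [neverLate, Timed.val_bind, val_op, hc]
      simpa using ih (t + 1) 0 (by omega) (by intros; omega)
    · have h' : ∀ s, t - g ≤ s → s < t + 1 → f s ≠ c := by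
        intro s h1 h2
        rcases Nat.lt_succ_iff_lt_or_eq.1 h2 with h2 | rfl
        exacts [h s h1 h2, hc]
      -- Lateness would make the window of `a` days from `t - g` free of the letter; `g ≤ t` keeps
      -- this subtraction exact.
      have hlate : ¬ a ≤ g + 1 := by
        intro hle
        obtain ⟨s, h1, h2, h3⟩ := hf (t - g)
        exact h' s h1 (by omega) h3
      simp only [neverLate, Timed.val_bind, val_op, hc]
      simpa [hlate] using ih (t + 1) (g + 1) (by omega) (fun s h1 h2 => h' s (by omega) h2)

/-! ### Holiday fractions of walks and of closed walks -/

/-- Starting with ages `g`, the word `w` keeps every task of `B` younger than its period. -/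
def IsWalk (B : List ℕ) (g : Fin B.length → ℕ) (w : List ℕ) : Prop :=
  ∀ j : Fin B.length, (neverLate B[j] (j + 1) (g j) w).val = true

/-- The ages of the tasks of `B` after the word `w`. -/
def agesAfter (B : List ℕ) (g : Fin B.length → ℕ) (w : List ℕ) (j : Fin B.length) : ℕ :=
  (daysSince (j + 1) (g j) w).val

theorem isWalk_append {B : List ℕ} {g : Fin B.length → ℕ} {u v : List ℕ} :
    IsWalk B g (u ++ v) ↔ IsWalk B g u ∧ IsWalk B (agesAfter B g u) v := by
  simp only [IsWalk, neverLate_append, forall_and, agesAfter]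

theorem agesAfter_append {B : List ℕ} {g : Fin B.length → ℕ} {u v : List ℕ} :
    agesAfter B g (u ++ v) = agesAfter B (agesAfter B g u) v := by
  funext j; simp only [agesAfter, daysSince_append]

theorem agesAfter_lt {B : List ℕ} {g : Fin B.length → ℕ} {w : List ℕ} (hg : ∀ j, g j < B[j])
    (hw : IsWalk B g w) (j : Fin B.length) : agesAfter B g w j < B[j] :=
  daysSince_lt_of_neverLate (hg j) (hw j)

theorem allValid_of_closed {B : List ℕ} {g : Fin B.length → ℕ} {w : List ℕ} (hw : w ≠ [])
    (h : IsWalk B g w) (hg : agesAfter B g w = g) : (allValid w 1 B).val = true := by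
  rw [allValid_iff]
  intro j hj
  have := taskValid_of_closed hw (h ⟨j, hj⟩) (congrFun hg ⟨j, hj⟩)
  simpa [add_comm] using this

/-- Pigeonhole: the prefixes of lengths `0, …, N` give `N + 1` age vectors among at most `N`
possible ones. The piece between two equal vectors is closed, and removing it leaves a walk because
the ages match at the seam. -/
theorem exists_closed_subwalk {B : List ℕ} {g : Fin B.length → ℕ} {w : List ℕ} {N : ℕ}
    (hg : ∀ j, g j < B[j]) (hN : ∏ j : Fin B.length, B[j] ≤ N) (hw : IsWalk B g w)
    (hlen : N < w.length) :
    ∃ u v x, w = u ++ v ++ x ∧ v ≠ [] ∧ v.length ≤ N ∧ (allValid v 1 B).val = true ∧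
      IsWalk B g (u ++ x) := by
  have htake : ∀ i, IsWalk B g (w.take i) := fun i =>
    (isWalk_append.1 ((List.take_append_drop i w).symm ▸ hw)).1
  let s : Fin (N + 1) → ∀ j : Fin B.length, Fin B[j] := fun i j =>
    ⟨agesAfter B g (w.take i) j, agesAfter_lt hg (htake i) j⟩
  obtain ⟨i, i', hne, hs⟩ := Fintype.exists_ne_map_eq_of_card_lt s (by
    simp only [Fintype.card_pi, Fintype.card_fin]
    omega)
  wlog hlt : i < i' generalizing i i'
  · exact this i' i hne.symm hs.symm (lt_of_le_of_ne (not_lt.1 hlt) hne.symm)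
  have hs' : agesAfter B g (w.take i) = agesAfter B g (w.take i') := by
    funext j
    exact congrArg Fin.val (congrFun hs j)
  have hlt' : (i : ℕ) < i' := hlt
  have hi' : (i' : ℕ) ≤ N := by omega
  have e : w.take i' = w.take i ++ (w.take i').drop i := by
    conv_lhs => rw [← List.take_append_drop i (w.take i')]
    rw [List.take_take, min_eq_left hlt'.le]
  have hv := isWalk_append.1 (e ▸ htake i')
  have hne : (w.take i').drop i ≠ [] := by
    rw [← List.length_pos_iff]; simp; omega
  refine ⟨w.take i, (w.take i').drop i, w.drop i', ?_, hne, by simp; omega, ?_, ?_⟩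
  · rw [← e, List.take_append_drop]
  · refine allValid_of_closed hne hv.2 ?_
    rw [← agesAfter_append, ← e, hs']
  · refine isWalk_append.2 ⟨htake i, ?_⟩
    rw [hs']
    exact (isWalk_append.1 ((List.take_append_drop i' w).symm ▸ hw)).2

/-- Closed pieces are cut out until at most `N` letters remain; each piece obeys the bound with no
error. -/
theorem count_le_of_isWalk {B : List ℕ} {g : Fin B.length → ℕ} {N k : ℕ} {h : ℚ} (hh : -1 ≤ h)
    (hg : ∀ j, g j < B[j]) (hN : ∏ j : Fin B.length, B[j] ≤ N)
    (hclosed : ∀ v : List ℕ, v ≠ [] → v.length ≤ N → (∀ c ∈ v, c < k) →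
      (allValid v 1 B).val = true → (v.count 0 : ℚ) ≤ h * v.length)
    (w : List ℕ) (hk : ∀ c ∈ w, c < k) (hw : IsWalk B g w) :
    (w.count 0 : ℚ) ≤ h * w.length + 2 * N := by
  induction hM : w.length using Nat.strong_induction_on generalizing w with
  | _ M ih =>
  subst hM
  rcases le_or_gt w.length N with hle | hlt
  · have h1 : (w.count 0 : ℚ) ≤ w.length := by exact_mod_cast List.count_le_length
    have h2 : (w.length : ℚ) ≤ N := by exact_mod_cast hle
    have h3 : (0 : ℚ) ≤ w.length := by positivity
    -- The remainder has at most `N` holidays, and `h ≥ -1` gives `h * w.length ≥ -N`; hence the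
    -- error `2 * N`.
    nlinarith
  · obtain ⟨u, v, x, rfl, hv0, hvN, hvv, hux⟩ := exists_closed_subwalk hg hN hw hlt
    have h1 := hclosed v hv0 hvN (fun c hc => hk c (by simp [hc])) hvv
    have hpos := List.length_pos_iff.2 hv0
    have h2 := ih (u ++ x).length (by simp; omega) (u ++ x)
      (fun c hc => hk c (by simp only [List.mem_append] at hc ⊢; tauto)) hux rfl
    simp only [List.count_append, List.length_append, Nat.cast_add] at h1 h2 ⊢
    linarith

/-! ### The answer "unschedulable" -/

/-- The tasks whose periods pass a test, in order. -/
def tasksWhere {m : ℕ} (A : Fin m → ℕ) (P : ℕ → Prop) [DecidablePred P] : List (Fin m) :=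
  (List.finRange m).filter fun i => P (A i)

theorem mem_tasksWhere {m : ℕ} {A : Fin m → ℕ} {P : ℕ → Prop} [DecidablePred P] {i : Fin m} :
    i ∈ tasksWhere A P ↔ P (A i) := by simp [tasksWhere]

theorem filter_ofFn {m : ℕ} (A : Fin m → ℕ) (P : ℕ → Prop) [DecidablePred P] :
    (List.ofFn A).filter (fun j => P j) = (tasksWhere A P).map A := by
  rw [List.ofFn_eq_map, List.filter_map]
  rfl

theorem recipSum_filter_ofFn {m : ℕ} (A : Fin m → ℕ) (P : ℕ → Prop) [DecidablePred P] :
    recipSum ((List.ofFn A).filter fun j => P j) =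
      ∑ i with P (A i), 1 / (A i : ℚ) := by
  have hnd : (tasksWhere A P).Nodup := (List.nodup_finRange m).filter _
  have e : (Finset.univ.filter fun i => P (A i)) = (tasksWhere A P).toFinset := by
    ext i; simp [mem_tasksWhere]
  rw [filter_ofFn, recipSum, List.map_map, e, List.sum_toFinset _ hnd]
  rfl

theorem recipSum_ofFn {m : ℕ} (A : Fin m → ℕ) :
    recipSum (List.ofFn A) = ∑ i, 1 / (A i : ℚ) := by
  have := recipSum_filter_ofFn A (fun _ => True)
  simpa using this

/-- The length of the time interval is a multiple of every period, so the floors in the validity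
condition lose nothing. The factor `T` makes the interval arbitrarily long. -/
theorem le_card_of_isValid {m : ℕ} {A : Fin m → ℕ} (hA : ∀ i, 1 ≤ A i) {σ : Schedule (Fin m)}
    (hσ : σ.IsValid fun i => (A i : ℝ)) (S : Finset (Fin m)) (T : ℕ) :
    (((∏ i, A i) * T : ℕ) : ℚ) * ∑ i ∈ S, 1 / (A i : ℚ) ≤
      ((Finset.range ((∏ i, A i) * T)).filter fun s : ℕ => ∃ i ∈ S, σ s = some i).card := by
  set M := (∏ i, A i) * T with hM
  have h1 : ∀ i, (M : ℚ) * (1 / (A i : ℚ)) ≤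
      ((Finset.range M).filter fun s : ℕ => σ s = some i).card := by
    intro i
    obtain ⟨r, hr⟩ : A i ∣ M := (Finset.dvd_prod_of_mem A (Finset.mem_univ i)).mul_right T
    have h0 : (A i : ℚ) ≠ 0 := by have := hA i; positivity
    have h0' : (A i : ℝ) ≠ 0 := by have := hA i; positivity
    have h2 := hσ i 0 M
    have e1 : (M : ℝ) / A i = r := by rw [hr]; push_cast; field_simp
    have e2 : (M : ℚ) * (1 / (A i : ℚ)) = r := by rw [hr]; push_cast; field_simp
    rw [e1, Nat.floor_natCast] at h2
    rw [e2]
    have h3 : ((Finset.Ico (0 : ℤ) (0 + M)).filter fun s => σ s = some i).card ≤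
        ((Finset.range M).filter fun s : ℕ => σ s = some i).card := by
      refine Finset.card_le_card_of_injOn Int.toNat ?_ ?_
      · intro s hs
        simp only [Finset.coe_filter, Finset.mem_Ico, Set.mem_ofPred_eq, Finset.mem_range] at hs ⊢
        refine ⟨by omega, ?_⟩
        rw [Int.toNat_of_nonneg hs.1.1]; exact hs.2
      · intro s hs t ht hst
        simp only [Finset.coe_filter, Finset.mem_Ico, Set.mem_ofPred_eq] at hs ht
        omega
    exact_mod_cast h2.trans h3
  have e : (Finset.range M).filter (fun s : ℕ => ∃ i ∈ S, σ s = some i) =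
      S.biUnion fun i => (Finset.range M).filter fun s : ℕ => σ s = some i := by
    ext s; simp; tauto
  rw [e, Finset.card_biUnion, Finset.mul_sum]
  · push_cast
    exact Finset.sum_le_sum fun i _ => h1 i
  · intro i _ j _ hij
    rw [Function.onFun, Finset.disjoint_left]
    intro s hs ht
    simp only [Finset.mem_filter] at hs ht
    exact hij (Option.some.inj (hs.2.symm.trans ht.2))

theorem recipSum_le_one_of_schedulable {m : ℕ} {A : Fin m → ℕ} (hA : ∀ i, 1 ≤ A i)
    (h : Schedulable fun i => (A i : ℝ)) : recipSum (List.ofFn A) ≤ 1 := by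
  obtain ⟨σ, hσ⟩ := h
  have h1 := le_card_of_isValid hA hσ Finset.univ 1
  have h2 := Finset.card_filter_le (Finset.range ((∏ i, A i) * 1))
    fun s : ℕ => ∃ i ∈ Finset.univ, σ s = some i
  rw [Finset.card_range] at h2
  have h3 : (0 : ℚ) < ((∏ i, A i) * 1 : ℕ) := by
    have : 0 < ∏ i, A i := Finset.prod_pos fun i _ => hA i
    exact_mod_cast by simpa using this
  rw [recipSum_ofFn]
  have h4 := h1.trans (Nat.cast_le.2 h2)
  exact le_of_mul_le_mul_left (by linarith) h3

/-- Each period up to `l` contributes at least `1 / l` to the density. -/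
theorem length_filter_le_le (A : List ℕ) (hA : ∀ a ∈ A, 1 ≤ a) (l : ℕ) :
    ((A.filter fun j => j ≤ l).length : ℚ) ≤ l * recipSum (A.filter fun j => j ≤ l) := by
  induction A with
  | nil => simp
  | cons a A ih =>
    have ih' := ih fun b hb => hA b (by simp [hb])
    by_cases h : a ≤ l
    · have ha : (0 : ℚ) < a := by exact_mod_cast hA a (by simp)
      have h1 : (1 : ℚ) ≤ l * (a : ℚ)⁻¹ := by
        rw [← div_eq_mul_inv, le_div_iff₀ ha]
        simpa using h
      simp [h] at ih' ⊢; linarith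
    · simpa [h] using ih'

theorem length_filter_le_of_recipSum_le_one {A : List ℕ} (hA : ∀ a ∈ A, 1 ≤ a)
    (h : recipSum A ≤ 1) (l : ℕ) : (A.filter fun j => j ≤ l).length ≤ l := by
  have h1 := length_filter_le_le A hA l
  have h2 := (recipSum_filter_le A fun j => j ≤ l).trans h
  have h3 : (0 : ℚ) ≤ l := by positivity
  have : ((A.filter fun j => j ≤ l).length : ℚ) ≤ l := by nlinarith
  exact_mod_cast this

theorem count_zero_map_range (f : ℕ → ℕ) (M : ℕ) :
    ((List.range M).map f).count 0 = ((Finset.range M).filter fun s => f s = 0).card := by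
  induction M with
  | zero => simp
  | succ M ih =>
    rw [List.range_succ, Finset.range_add_one, Finset.filter_insert]
    by_cases h : f M = 0 <;> simp [h, ih]

/-- Reading the non-big tasks as holidays turns a valid schedule into arbitrarily long walks from
age zero. With `d` the density of those tasks, `M` days have at least `M * d` holidays and, by the
decomposition into closed walks, at most `H * M + 2 * l ^ l`; letting `M` grow gives `d ≤ H`. -/
theorem le_periodLoop_of_schedulable {m : ℕ} {A : Fin m → ℕ} (hA : ∀ i, 1 ≤ A i)
    (h : Schedulable fun i => (A i : ℝ)) {l : ℕ} (hl : 1 ≤ l) {B : List ℕ}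
    (hB : B = (List.ofFn A).filter fun j => j ≤ l) :
    recipSum ((List.ofFn A).filter fun j => l < j) ≤
      (periodLoop B (B.length + 1) (l ^ l) 1 (-1)).val := by
  have hD := recipSum_le_one_of_schedulable hA h
  have hlen := length_filter_le_of_recipSum_le_one (A := List.ofFn A)
    (by simpa [List.mem_ofFn] using hA) hD l
  obtain ⟨σ, hσ⟩ := h
  rw [← hB] at hlen
  set H := (periodLoop B (B.length + 1) (l ^ l) 1 (-1)).val with hH
  have hHle := le_periodLoop_iff B (B.length + 1) (by omega) (l ^ l) 1 (-1)
  rw [← hH] at hHle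
  have hH1 : -1 ≤ H := (hHle _).2 (.inl le_rfl)
  let I := tasksWhere A (· ≤ l)
  have hI : I.Nodup := (List.nodup_finRange m).filter _
  have hBI : B = I.map A := by rw [hB, filter_ofFn A (· ≤ l)]
  have hBlen : B.length = I.length := by simp [hBI]
  -- the word read off the schedule
  let f : ℕ → ℕ := fun s => match σ s with
    | none => 0
    | some i => if i ∈ I then I.idxOf i + 1 else 0
  have hfk : ∀ s, f s < B.length + 1 := by
    intro s
    simp only [f]
    rcases σ s with _ | i
    · simp
    · by_cases hi : i ∈ I
      · simpa [hi, hBlen] using List.idxOf_lt_length_iff.2 hi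
      · simp [hi]
  have hBl : ∀ j : Fin B.length, 1 ≤ B[j] ∧ B[j] ≤ l := by
    intro j
    have : B[j] ∈ (List.ofFn A).filter fun j => j ≤ l := hB ▸ List.getElem_mem j.2
    simp only [List.mem_filter, List.mem_ofFn, decide_eq_true_eq] at this
    obtain ⟨⟨i, hi⟩, h⟩ := this
    exact ⟨hi ▸ hA i, h⟩
  have hN : ∏ j : Fin B.length, B[j] ≤ l ^ l :=
    calc ∏ j : Fin B.length, B[j] ≤ ∏ _j : Fin B.length, l :=
          Finset.prod_le_prod' fun j _ => (hBl j).2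
      _ = l ^ B.length := by simp
      _ ≤ l ^ l := Nat.pow_le_pow_right hl hlen
  have hwalk : ∀ M, IsWalk B (fun _ => 0) ((List.range' 0 M).map f) := by
    intro M j
    refine neverLate_map_range' (fun t => ?_) M 0 0 le_rfl (by intros; omega)
    have hj : (j : ℕ) < I.length := hBlen ▸ j.2
    have h1 := hσ I[(j : ℕ)] t (A I[(j : ℕ)])
    have hAj : (A I[(j : ℕ)] : ℝ) ≠ 0 := by have := hA I[(j : ℕ)]; positivity
    rw [div_self hAj, Nat.floor_one] at h1
    obtain ⟨s, hs⟩ := Finset.card_pos.1 h1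
    simp only [Finset.mem_filter, Finset.mem_Ico] at hs
    have hBj : B[j] = A I[(j : ℕ)] := by simp [hBI]
    refine ⟨s.toNat, by omega, by rw [hBj]; omega, ?_⟩
    simp only [f, Int.toNat_of_nonneg (show 0 ≤ s by omega), hs.2]
    simp [List.Nodup.idxOf_getElem hI]
  have hcount : ∀ T : ℕ, ((((∏ i, A i) * T : ℕ) : ℚ)) *
      recipSum ((List.ofFn A).filter fun j => l < j) ≤
        H * (((∏ i, A i) * T : ℕ) : ℚ) + 2 * ((l ^ l : ℕ) : ℚ) := by
    intro T
    have h1 := le_card_of_isValid hA hσ (Finset.univ.filter fun i => l < A i) T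
    rw [← recipSum_filter_ofFn A (fun j => l < j)] at h1
    set M := (∏ i, A i) * T
    have h2 := count_le_of_isWalk (N := l ^ l) (k := B.length + 1) hH1
      (fun j => (hBl j).1) hN (fun v hv hvN hvk hvv => by
        have hpos : (0 : ℚ) < v.length := by exact_mod_cast List.length_pos_iff.2 hv
        have := (hHle _).2 (.inr ⟨v, List.length_pos_iff.2 hv, by omega, hvk, hvv, le_rfl⟩)
        rwa [div_le_iff₀ hpos] at this)
      ((List.range' 0 M).map f) (by
        intro c hc
        obtain ⟨s, -, rfl⟩ := List.mem_map.1 hc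
        exact hfk s) (hwalk M)
    have h3 : ((Finset.range M).filter
        fun s : ℕ => ∃ i ∈ Finset.univ.filter (fun i => l < A i), σ s = some i).card ≤
        ((List.range' 0 M).map f).count 0 := by
      rw [← List.range_eq_range', count_zero_map_range]
      refine Finset.card_le_card fun s hs => ?_
      simp only [Finset.mem_filter, Finset.mem_univ, true_and] at hs ⊢
      obtain ⟨hs, i, hi, hsi⟩ := hs
      refine ⟨hs, ?_⟩
      have : i ∉ I := by simp [I, mem_tasksWhere, hi]
      simp [f, hsi, this]
    have h4 : (((Finset.range M).filter
        fun s : ℕ => ∃ i ∈ Finset.univ.filter (fun i => l < A i), σ s = some i).card : ℚ) ≤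
        (((List.range' 0 M).map f).count 0 : ℚ) := by exact_mod_cast h3
    simp only [List.length_map, List.length_range'] at h2
    linarith
  by_contra! hcon
  set d := recipSum ((List.ofFn A).filter fun j => l < j)
  have hQ : (1 : ℚ) ≤ ((∏ i, A i : ℕ) : ℚ) := by
    have : 0 < ∏ i, A i := Finset.prod_pos fun i _ => hA i
    exact_mod_cast this
  -- For this `T` the linear gap `d - H` outgrows the bounded error.
  obtain ⟨T, hT⟩ := exists_nat_gt (2 * ((l ^ l : ℕ) : ℚ) / (d - H))
  rw [div_lt_iff₀ (by linarith)] at hT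
  have h1 := hcount T
  have hT0 : (0 : ℚ) ≤ T := by positivity
  rw [Nat.cast_mul] at h1
  have h2 : (T : ℚ) * (d - H) ≤ ((∏ i, A i : ℕ) : ℚ) * (T * (d - H)) :=
    le_mul_of_one_le_left (mul_nonneg hT0 (by linarith)) hQ
  linarith

/-! ### Assigning unit jobs with interval windows to free slots -/

open Classical in
/-- The times in `[x, y)` that satisfy `F`. -/
noncomputable def slots (F : ℤ → Prop) (x y : ℝ) : Finset ℤ :=
  (Finset.Ico ⌈x⌉ ⌈y⌉).filter F

theorem mem_slots {F : ℤ → Prop} {x y : ℝ} {t : ℤ} :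
    t ∈ slots F x y ↔ (x ≤ t ∧ (t : ℝ) < y) ∧ F t := by
  simp [slots, Int.ceil_le, Int.lt_ceil]

/-- If the windows of `S` cover their hull, the hypothesis for the hull is Hall's condition.
Otherwise an uncovered point `z` splits `S` into the windows that end by `z` and those that start
after it; their slots are disjoint, and induction applies to both smaller sets. -/
theorem card_le_card_biUnion_slots {J : Type*} [DecidableEq J] {F : ℤ → Prop} {s e : J → ℝ}
    (h : ∀ (S : Finset J) (x y : ℝ), S.Nonempty → (∀ j ∈ S, x ≤ s j ∧ e j ≤ y) →
      S.card ≤ (slots F x y).card) (S : Finset J) :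
    S.card ≤ (S.biUnion fun j => slots F (s j) (e j)).card := by
  induction hM : S.card using Nat.strong_induction_on generalizing S with
  | _ M ih =>
  subst hM
  rcases S.eq_empty_or_nonempty with rfl | hS
  · simp
  obtain ⟨j0, hj0, hx0⟩ := S.exists_min_image s hS
  obtain ⟨j1, hj1, hy1⟩ := S.exists_max_image e hS
  by_cases hcon : ∀ z, s j0 ≤ z → z < e j1 → ∃ j ∈ S, s j ≤ z ∧ z < e j
  · refine (h S (s j0) (e j1) hS fun j hj => ⟨hx0 j hj, hy1 j hj⟩).trans
      (Finset.card_le_card fun t ht => ?_)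
    rw [mem_slots] at ht
    obtain ⟨j, hj, h1, h2⟩ := hcon t ht.1.1 ht.1.2
    exact Finset.mem_biUnion.2 ⟨j, hj, mem_slots.2 ⟨⟨h1, h2⟩, ht.2⟩⟩
  · push Not at hcon
    obtain ⟨z, hz0, hz1, hz⟩ := hcon
    set S1 := S.filter fun j => e j ≤ z
    set S2 := S.filter fun j => ¬ e j ≤ z
    have hsum : S1.card + S2.card = S.card := Finset.card_filter_add_card_filter_not _
    have h1 : 0 < S1.card :=
      Finset.card_pos.2 ⟨j0, Finset.mem_filter.2 ⟨hj0, hz j0 hj0 hz0⟩⟩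
    have h2 : 0 < S2.card :=
      Finset.card_pos.2 ⟨j1, Finset.mem_filter.2 ⟨hj1, not_le.2 hz1⟩⟩
    have g1 := ih S1.card (by omega) S1 rfl
    have g2 := ih S2.card (by omega) S2 rfl
    have hdisj : Disjoint (S1.biUnion fun j => slots F (s j) (e j))
        (S2.biUnion fun j => slots F (s j) (e j)) := by
      rw [Finset.disjoint_left]
      intro t ht1 ht2
      obtain ⟨j, hj, ht1⟩ := Finset.mem_biUnion.1 ht1
      obtain ⟨j', hj', ht2⟩ := Finset.mem_biUnion.1 ht2
      rw [mem_slots] at ht1 ht2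
      have k1 := (Finset.mem_filter.1 hj).2
      obtain ⟨k2, k3⟩ := Finset.mem_filter.1 hj'
      have k4 : z < s j' := by
        by_contra k4
        exact k3 (hz j' k2 (not_lt.1 k4))
      linarith [ht1.1.2, ht2.1.1]
    calc S.card = S1.card + S2.card := hsum.symm
      _ ≤ _ := add_le_add g1 g2
      _ = _ := (Finset.card_union_of_disjoint hdisj).symm
      _ ≤ _ := Finset.card_le_card (Finset.union_subset
        (Finset.biUnion_subset_biUnion_of_subset_left _ (Finset.filter_subset _ _))
        (Finset.biUnion_subset_biUnion_of_subset_left _ (Finset.filter_subset _ _)))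

/-- Jobs with interval windows can be assigned to distinct free slots in their windows if no
interval contains the windows of more jobs than it has free slots. -/
theorem exists_assignment {J : Type*} {F : ℤ → Prop} {s e : J → ℝ}
    (h : ∀ (S : Finset J) (x y : ℝ), S.Nonempty → (∀ j ∈ S, x ≤ s j ∧ e j ≤ y) →
      S.card ≤ (slots F x y).card) :
    ∃ f : J → ℤ, Function.Injective f ∧ ∀ j, (s j ≤ f j ∧ (f j : ℝ) < e j) ∧ F (f j) := by
  classical
  obtain ⟨f, hf, hf'⟩ := (Finset.all_card_le_biUnion_card_iff_exists_injective
    fun j => slots F (s j) (e j)).1 (card_le_card_biUnion_slots h)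
  exact ⟨f, hf, fun j => mem_slots.1 (hf' j)⟩

/-! ### Counting windows in an interval -/

/-- The slack `θ` in `hxy` is exactly what makes the bound nonnegative; it is needed when `y` is the
latest start of a window that ends inside an interval. -/
theorem card_progression_le {θ x y : ℝ} (hθ : 0 < θ) (hxy : x ≤ y + θ) (S : Finset ℤ)
    (hS : ∀ k ∈ S, x ≤ k * θ ∧ k * θ ≤ y) : (S.card : ℝ) ≤ (y - x) / θ + 1 := by
  have hsub : S ⊆ Finset.Icc ⌈x / θ⌉ ⌊y / θ⌋ := fun k hk => by
    rw [Finset.mem_Icc, Int.ceil_le, Int.le_floor, div_le_iff₀ hθ, le_div_iff₀ hθ]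
    exact hS k hk
  have h1 : (S.card : ℝ) ≤ ((⌊y / θ⌋ + 1 - ⌈x / θ⌉).toNat : ℝ) := by
    have := Finset.card_le_card hsub
    rw [Int.card_Icc] at this
    exact_mod_cast this
  have h2 := Int.floor_le (y / θ)
  have h3 := Int.le_ceil (x / θ)
  have h4 : (y - x) / θ + 1 = y / θ - x / θ + 1 := by rw [sub_div]
  rcases le_or_gt 0 (⌊y / θ⌋ + 1 - ⌈x / θ⌉) with h0 | h0
  · have e : ((⌊y / θ⌋ + 1 - ⌈x / θ⌉).toNat : ℝ) = ((⌊y / θ⌋ + 1 - ⌈x / θ⌉ : ℤ) : ℝ) := by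
      exact_mod_cast Int.toNat_of_nonneg h0
    rw [e] at h1
    push_cast at h1
    linarith
  · rw [Int.toNat_of_nonpos h0.le] at h1
    have : -1 ≤ (y - x) / θ := by rw [le_div_iff₀ hθ]; linarith
    push_cast at h1
    linarith

/-- A task with a slot in each of the windows `[k τ + φ, k τ + φ + w)` meets the period `b`
if `τ + w ≤ b`. -/
theorem floor_le_card_of_windows {τ w φ b : ℝ} (hτ : 0 < τ) (hw : 0 < w) (hb : τ + w ≤ b)
    {f : ℤ → ℤ} (hf : Function.Injective f)
    (hfw : ∀ k : ℤ, k * τ + φ ≤ f k ∧ (f k : ℝ) < k * τ + φ + w)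
    (P : ℤ → Prop) [DecidablePred P] (hP : ∀ k, P (f k)) (t : ℤ) (L : ℕ) :
    ⌊(L : ℝ) / b⌋₊ ≤ ((Finset.Ico t (t + L)).filter P).card := by
  set q := ⌊(L : ℝ) / b⌋₊ with hq
  have hb0 : 0 < b := by linarith
  have hqL : (q : ℝ) * b ≤ L := by
    rw [← le_div_iff₀ hb0]
    exact Nat.floor_le (by positivity)
  -- The first window starting at or after `t`. Window `k0 + i` ends before `t + (i + 1) * τ + w`,
  -- which for `i < q` is at most `t + q * (τ + w) ≤ t + L`.
  set k0 := ⌈((t : ℝ) - φ) / τ⌉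
  have h1 : (t : ℝ) - φ ≤ k0 * τ := by
    rw [← div_le_iff₀ hτ]; exact Int.le_ceil _
  have h2 : (k0 : ℝ) * τ < t - φ + τ := by
    have := Int.ceil_lt_add_one (((t : ℝ) - φ) / τ)
    have h3 : (k0 : ℝ) - 1 < ((t : ℝ) - φ) / τ := by linarith
    rw [lt_div_iff₀ hτ] at h3
    linarith
  have hcard : (Finset.range q).card = q := Finset.card_range q
  rw [← hcard]
  refine Finset.card_le_card_of_injOn (fun i : ℕ => f (k0 + i)) ?_ ?_
  · intro i hi
    have hi' : i + 1 ≤ q := Finset.mem_range.1 hi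
    have hi'' : (i : ℝ) + 1 ≤ q := by exact_mod_cast hi'
    obtain ⟨g1, g2⟩ := hfw (k0 + i)
    push_cast at g1 g2
    have hi0 : (0 : ℝ) ≤ i := by positivity
    simp only [Finset.coe_filter, Finset.mem_Ico, Set.mem_ofPred_eq]
    refine ⟨⟨?_, ?_⟩, hP _⟩
    · have : (t : ℝ) ≤ f (k0 + i) := by nlinarith
      exact_mod_cast this
    · have h5 : ((i : ℝ) + 1) * τ ≤ q * τ := by gcongr
      have h6 : w ≤ q * w := le_mul_of_one_le_left hw.le (by linarith)
      have h7 : (q : ℝ) * (τ + w) ≤ q * b := by gcongr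
      have : (f (k0 + i) : ℝ) < t + L := by nlinarith
      exact_mod_cast this
  · intro i _ j _ hij
    have := hf hij
    omega

theorem exists_index {ι : Type*} (s : Finset ι) :
    ∃ idx : ι → ℕ, Set.InjOn idx s ∧ ∀ i ∈ s, idx i < s.card := by
  classical
  refine ⟨fun i => if h : i ∈ s then s.equivFin ⟨i, h⟩ else 0, ?_, ?_⟩
  · intro i hi j hj hij
    have hi' : i ∈ s := hi
    have hj' : j ∈ s := hj
    simp only [hi', hj', dif_pos] at hij
    simpa using s.equivFin.injective (Fin.ext hij)
  · intro i hi
    simp only [hi, dif_pos]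
    exact (s.equivFin ⟨i, hi⟩).2

/-- The numbers of jobs of staggered tasks with a common period `τ` whose windows lie in an
interval. -/
theorem card_staggered_le {ι : Type*} [DecidableEq ι] {C : Finset ι} {idx : ι → ℕ}
    (hinj : Set.InjOn idx C) (hidx : ∀ i ∈ C, idx i < C.card) {τ w x y : ℝ} (hτ : 0 < τ)
    (hw : 0 ≤ w) (hxy : x + w ≤ y) (S : Finset (ι × ℤ)) (hSC : ∀ j ∈ S, j.1 ∈ C)
    (hS : ∀ j ∈ S, x ≤ j.2 * τ + idx j.1 * (τ / C.card) ∧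
      j.2 * τ + idx j.1 * (τ / C.card) + w ≤ y) :
    (S.card : ℝ) ≤ (y - x) * (C.card / τ) + 1 := by
  rcases S.eq_empty_or_nonempty with rfl | ⟨j0, hj0⟩
  · have : 0 ≤ (y - x) * (C.card / τ) := mul_nonneg (by linarith) (by positivity)
    simp; linarith
  have hκ : 0 < C.card := Finset.card_pos.2 ⟨_, hSC j0 hj0⟩
  have hκ' : (0 : ℝ) < C.card := by exact_mod_cast hκ
  -- Numbering the windows of all tasks of the class in order of their starts gives a single
  -- progression of step `τ / C.card`, so the whole class pays one rounding error instead of one per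
  -- task.
  set N : ι × ℤ → ℤ := fun j => j.2 * C.card + idx j.1 with hN
  have hNinj : Set.InjOn N S := by
    rintro ⟨i, k⟩ hi ⟨i', k'⟩ hi' h
    have e1 := hidx i (hSC _ hi)
    have e2 := hidx i' (hSC _ hi')
    simp only [hN] at h
    have hkk : k = k' := by
      rcases lt_trichotomy k k' with hlt | heq | hgt
      · have : (k + 1) * (C.card : ℤ) ≤ k' * C.card := by gcongr; omega
        nlinarith
      · exact heq
      · have : (k' + 1) * (C.card : ℤ) ≤ k * C.card := by gcongr; omega
        nlinarith
    subst hkk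
    have hii : idx i = idx i' := by omega
    exact Prod.ext (hinj (hSC _ hi) (hSC _ hi') hii) rfl
  have hθ : 0 < τ / C.card := by positivity
  have h1 := card_progression_le hθ (x := x) (y := y - w) (by linarith) (S.image N) (by
    intro k hk
    obtain ⟨j, hj, rfl⟩ := Finset.mem_image.1 hk
    have e : (N j : ℝ) * (τ / C.card) = j.2 * τ + idx j.1 * (τ / C.card) := by
      simp only [hN]; push_cast; field_simp
    rw [e]
    have := hS j hj
    exact ⟨this.1, by linarith⟩)
  rw [Finset.card_image_of_injOn hNinj] at h1
  have e : (y - w - x) / (τ / C.card) = (y - w - x) * (C.card / τ) := by field_simp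
  rw [e] at h1
  have : (y - w - x) * (C.card / τ) ≤ (y - x) * (C.card / τ) := by gcongr; linarith
  linarith

/-! ### Windows for medium and small tasks -/

/-- The windows of one task abut, their length being their spacing. The `+ 1` of the progression
bound then cancels against the window length, so the demand has no additive error and the bound
works on intervals of every length. -/
theorem card_half_windows_le {ι : Type*} [DecidableEq ι] {M : Finset ι} {b : ι → ℝ}
    (hb : ∀ i ∈ M, 0 < b i) {x y : ℝ} (hxy : x ≤ y) (S : Finset (ι × ℤ)) (hSM : ∀ j ∈ S, j.1 ∈ M)
    (hS : ∀ j ∈ S, x ≤ j.2 * (b j.1 / 2) ∧ j.2 * (b j.1 / 2) + b j.1 / 2 ≤ y) :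
    (S.card : ℝ) ≤ (y - x) * (2 * ∑ i ∈ M, 1 / b i) := by
  have h1 : S.card = ∑ i ∈ M, (S.filter fun j => j.1 = i).card :=
    Finset.card_eq_sum_card_fiberwise hSM
  rw [h1, Finset.mul_sum, Finset.mul_sum]
  push_cast
  refine Finset.sum_le_sum fun i hi => ?_
  have hbi := hb i hi
  have h2 := card_progression_le (θ := b i / 2) (x := x) (y := y - b i / 2) (by linarith)
    (by linarith) ((S.filter fun j => j.1 = i).image Prod.snd) (by
      intro k hk
      obtain ⟨j, hj, rfl⟩ := Finset.mem_image.1 hk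
      obtain ⟨hjS, rfl⟩ := Finset.mem_filter.1 hj
      have := hS j hjS
      exact ⟨this.1, by linarith⟩)
  rw [Finset.card_image_of_injOn] at h2
  · refine h2.trans (le_of_eq ?_)
    field_simp
    ring
  · rintro ⟨i1, k1⟩ h1 ⟨i2, k2⟩ h2 h
    have e1 : i1 = i := (Finset.mem_filter.1 h1).2
    have e2 : i2 = i := (Finset.mem_filter.1 h2).2
    exact Prod.ext (e1.trans e2.symm) h

/-- Bernoulli's inequality for the largest index `r` gives `w * (1 + r * ρ) ≤ L`, and `ρ ≤ 1`
absorbs the class with index zero. -/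
theorem card_le_div_of_geometric_le {ρ w L : ℝ} (hρ : 0 < ρ) (hρ1 : ρ ≤ 1) (hw : 0 < w)
    (R : Finset ℕ) (hR : ∀ r ∈ R, w * (1 + ρ) ^ r ≤ L) (hne : R.Nonempty) :
    (R.card : ℝ) ≤ L / (w * ρ) := by
  set r := R.max' hne
  have h1 : R.card ≤ r + 1 := by
    have : R ⊆ Finset.range (r + 1) := fun q hq =>
      Finset.mem_range.2 (Nat.lt_succ_of_le (R.le_max' q hq))
    simpa using Finset.card_le_card this
  have h2 := hR r (R.max'_mem hne)
  have h3 := one_add_mul_le_pow (show (-2 : ℝ) ≤ ρ by linarith) r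
  have h4 : (R.card : ℝ) ≤ r + 1 := by exact_mod_cast h1
  rw [le_div_iff₀ (by positivity)]
  have h5 : w * (1 + r * ρ) ≤ L := (mul_le_mul_of_nonneg_left h3 hw.le).trans h2
  have h6 : (R.card : ℝ) * (w * ρ) ≤ (r + 1) * (w * ρ) := by gcongr
  nlinarith

/-- The numerical estimate: long intervals have enough free slots. -/
theorem demand_le_supply {n N p : ℕ} (hn : 4 ≤ n) (hN : 64 * n ≤ N) (hp : p ≤ N)
    {h Dm Ds L : ℝ} (hDm : Dm ≤ 1 / (2 * (n + 1)))
    (hDs1 : Ds ≤ 1) (hh : Dm + Ds ≤ h) (hL : 2 * (n + 1) * N ≤ L) :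
    L * (2 * (n / (n + 1) * Dm)) +
        (L * ((1 + 1 / (8 * n)) / (1 - 1 / (8 * n)) * (n / (n + 1) * Ds)) +
          L / (2 * (n + 1) * N * (1 / (8 * n)))) ≤
      L * ((1 + h * n) / (n + 1)) - 2 - p / 4 := by
  have hn' : (4 : ℝ) ≤ n := by exact_mod_cast hn
  have hN' : 64 * (n : ℝ) ≤ N := by exact_mod_cast hN
  have hp' : (p : ℝ) ≤ N := by exact_mod_cast hp
  have hN0 : (256 : ℝ) ≤ N := by linarith
  have hL0 : 0 < L := lt_of_lt_of_le (by positivity) hL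
  have hc : (1 + 1 / (8 * (n : ℝ))) / (1 - 1 / (8 * n)) = 1 + 2 / (8 * n - 1) := by
    have : 8 * (n : ℝ) - 1 ≠ 0 := by linarith
    field_simp
    ring
  have hc' : 2 / (8 * (n : ℝ) - 1) * n ≤ 8 / 31 := by
    rw [div_mul_eq_mul_div, div_le_div_iff₀ (by linarith) (by norm_num)]
    linarith
  have h1 : L / (2 * (n + 1) * N * (1 / (8 * n))) ≤ L / (n + 1) * (1 / 16) := by
    rw [div_mul_div_comm, mul_one]
    refine div_le_div_of_nonneg_left hL0.le (by positivity) ?_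
    rw [mul_one_div, le_div_iff₀ (by positivity)]
    nlinarith
  have h2 : 2 + (p : ℝ) / 4 ≤ L / (n + 1) * (1 / 256 + 1 / 8) := by
    have : 2 * (N : ℝ) ≤ L / (n + 1) := by
      rw [le_div_iff₀ (by positivity)]; linarith
    nlinarith
  have h3 : n * Dm ≤ 1 / 2 := by
    calc n * Dm ≤ n * (1 / (2 * (n + 1))) := by gcongr
      _ ≤ 1 / 2 := by
        rw [mul_one_div, div_le_div_iff₀ (by positivity) (by norm_num)]; linarith
  have h4 : 2 / (8 * (n : ℝ) - 1) * n * Ds ≤ 8 / 31 := by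
    have : 0 ≤ 2 / (8 * (n : ℝ) - 1) * n := by
      have : 0 < 8 * (n : ℝ) - 1 := by linarith
      positivity
    calc _ ≤ 2 / (8 * (n : ℝ) - 1) * n * 1 := by gcongr
      _ ≤ _ := by linarith
  have h5 : n * Dm + n * Ds ≤ h * n := by nlinarith
  have hq : 0 < L / (n + 1) := by positivity
  have e1 : L * (2 * (n / (n + 1) * Dm)) = L / (n + 1) * (2 * (n * Dm)) := by ring
  have e2 : L * ((1 + 2 / (8 * (n : ℝ) - 1)) * (n / (n + 1) * Ds)) =
      L / (n + 1) * (n * Ds + 2 / (8 * (n : ℝ) - 1) * n * Ds) := by ring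
  have e3 : L * ((1 + h * n) / (n + 1)) = L / (n + 1) * (1 + h * n) := by ring
  rw [hc, e1, e2, e3]
  -- In units of `L / (n + 1)` the inserted slots supply 1. The excess demand is at most `1 / 2`
  -- from doubling the medium tasks, `8 / 31` from rounding the small ones, `1 / 16` from the number
  -- of classes and `1 / 256 + 1 / 8` from counting slots; the sum is below 1.
  have h6 : L / (n + 1) * (2 * (n * Dm) + (n * Ds + 2 / (8 * (n : ℝ) - 1) * n * Ds) + 1 / 16 +
      (1 / 256 + 1 / 8)) ≤ L / (n + 1) * (1 + h * n) :=
    mul_le_mul_of_nonneg_left (by linarith) hq.le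
  linarith

/-- `hF1` counts inserted slots only, without an additive error, and serves intervals holding only
medium windows, however short. `hF2` also counts holidays, with an error that is harmless on any
interval long enough to hold a small window. -/
theorem exists_assignment_of_density {ι : Type*} [Fintype ι] {n N p : ℕ} (hn : 4 ≤ n)
    (hN : 64 * n ≤ N) (hp : p ≤ N) {h : ℝ} {F : ℤ → Prop}
    (hF1 : ∀ x y : ℝ, x ≤ y → ⌊(y - x) / (n + 1)⌋₊ ≤ (slots F x y).card)
    (hF2 : ∀ x y : ℝ, x ≤ y →
      (y - x) * ((1 + h * n) / (n + 1)) - 2 - p / 4 ≤ (slots F x y).card)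
    {a : ι → ℝ} (ha : ∀ i, 0 < a i) (med : ι → Prop) [DecidablePred med]
    (hmed : ∑ i with med i, 1 / a i ≤ 1 / (2 * (n + 1)))
    (hsmall : ∀ i, ¬ med i → 16 * (n : ℝ) ^ 2 * N ≤ a i)
    (hh : ∑ i, 1 / a i ≤ h) (h1 : ∑ i, 1 / a i ≤ 1) :
    ∃ f : ι × ℤ → ℤ, Function.Injective f ∧ (∀ j, F (f j)) ∧
      ∀ i, ∃ τ w φ : ℝ, 0 < τ ∧ 0 < w ∧ τ + w ≤ (1 + 1 / n) * a i ∧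
        ∀ k : ℤ, k * τ + φ ≤ f (i, k) ∧ (f (i, k) : ℝ) < k * τ + φ + w := by
  classical
  have hn' : (4 : ℝ) ≤ n := by exact_mod_cast hn
  have hN' : 64 * (n : ℝ) ≤ N := by exact_mod_cast hN
  have hN0 : (0 : ℝ) < N := by linarith
  set ρ : ℝ := 1 / (8 * n) with hρ
  have hρ0 : 0 < ρ := by positivity
  have hρ1 : ρ ≤ 1 / 32 := by
    rw [hρ]; gcongr; linarith
  set c : ℝ := 1 + 1 / n with hc
  have hc0 : 0 < c := by positivity
  set u : ℝ := 16 * (n : ℝ) ^ 2 * N with hu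
  have hu0 : 0 < u := by positivity
  -- geometric classes of small tasks
  have hcls : ∀ i, ∃ r : ℕ, ¬ med i → u * (1 + ρ) ^ r ≤ a i ∧ a i < u * (1 + ρ) ^ (r + 1) := by
    intro i
    by_cases hi : med i
    · exact ⟨0, fun h => absurd hi h⟩
    · obtain ⟨r, hr1, hr2⟩ := exists_nat_pow_near (x := a i / u) (y := 1 + ρ)
        (by rw [one_le_div hu0]; exact hsmall i hi) (by linarith)
      rw [le_div_iff₀ hu0] at hr1
      rw [div_lt_iff₀ hu0] at hr2
      exact ⟨r, fun _ => ⟨by linarith, by linarith⟩⟩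
  choose cls hcls using hcls
  let α : ℕ → ℝ := fun r => c * (u * (1 + ρ) ^ r)
  have hα : ∀ r, 0 < α r := fun r => by positivity
  let C : ℕ → Finset ι := fun r => Finset.univ.filter fun i => ¬ med i ∧ cls i = r
  choose idx hidx1 hidx2 using fun r => exists_index (C r)
  -- In both cases `τ + w` is at most the stretched period: two halves for a medium task, `α (cls
  -- i)` for a small one. A small task gets a short window, because its density grows by the factor
  -- `1 / (1 - ρ)`.
  let τ : ι → ℝ := fun i => if med i then c * a i / 2 else (1 - ρ) * α (cls i)
  let w : ι → ℝ := fun i => if med i then c * a i / 2 else ρ * α (cls i)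
  let φ : ι → ℝ := fun i => if med i then 0 else
    idx (cls i) i * ((1 - ρ) * α (cls i) / (C (cls i)).card)
  obtain ⟨f, hf, hf'⟩ := exists_assignment (F := F)
    (s := fun j : ι × ℤ => j.2 * τ j.1 + φ j.1) (e := fun j => j.2 * τ j.1 + φ j.1 + w j.1) (by
    intro S x y hS hSxy
    have hwpos : ∀ i, 0 < w i := by
      intro i
      by_cases hi : med i
      · simp only [w, hi, if_true]; have := ha i; positivity
      · simp only [w, hi, if_false]; have := hα (cls i); positivity
    have hxy : x ≤ y := by
      obtain ⟨j, hj⟩ := hS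
      have := hSxy j hj
      have := hwpos j.1
      linarith
    set S1 := S.filter fun j => med j.1
    set S2 := S.filter fun j => ¬ med j.1
    have hcard : S1.card + S2.card = S.card := Finset.card_filter_add_card_filter_not _
    have hb1 : (S1.card : ℝ) ≤ (y - x) * (2 * ∑ i with med i, 1 / (c * a i)) := by
      refine card_half_windows_le (b := fun i => c * a i)
        (fun i _ => mul_pos hc0 (ha i)) hxy S1 (fun j hj => ?_) (fun j hj => ?_)
      · simpa using (Finset.mem_filter.1 hj).2
      · obtain ⟨hj, hjm⟩ := Finset.mem_filter.1 hj
        have := hSxy j hj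
        simpa [τ, φ, w, hjm] using this
    have hcn : ∀ z : ℝ, 1 / (c * z) = n / (n + 1) * (1 / z) := by
      intro z
      have : c = (n + 1) / n := by rw [hc]; field_simp
      rw [this, one_div, mul_inv, inv_div, one_div]
    have hb1' : ∑ i with med i, 1 / (c * a i) = n / (n + 1) * ∑ i with med i, 1 / a i := by
      rw [Finset.mul_sum]; exact Finset.sum_congr rfl fun i _ => hcn _
    rw [hb1'] at hb1
    rcases S2.eq_empty_or_nonempty with hS2 | hS2
    · rw [hS2, Finset.card_empty, add_zero] at hcard
      rw [← hcard]
      refine le_trans (Nat.le_floor ?_) (hF1 x y hxy)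
      refine hb1.trans ?_
      rw [div_eq_mul_one_div (y - x)]
      refine mul_le_mul_of_nonneg_left ?_ (by linarith)
      calc 2 * (n / (n + 1) * ∑ i with med i, 1 / a i)
          ≤ 2 * (n / (n + 1) * (1 / (2 * (n + 1)))) := by gcongr
        _ = n / (n + 1) * (1 / (n + 1)) := by field_simp
        _ ≤ 1 * (1 / (n + 1)) := by
          gcongr
          rw [div_le_one (by positivity)]; linarith
        _ = _ := one_mul _
    · set R := S2.image fun j => cls j.1
      have hR : ∀ j ∈ S2, ρ * α (cls j.1) ≤ y - x := by
        intro j hj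
        obtain ⟨hj, hjm⟩ := Finset.mem_filter.1 hj
        have := hSxy j hj
        simp only [w, hjm, if_false] at this
        linarith
      have hRL : ∀ r ∈ R, ρ * α r ≤ y - x := by
        intro r hr
        obtain ⟨j, hj, rfl⟩ := Finset.mem_image.1 hr
        exact hR j hj
      have hRcard : (R.card : ℝ) ≤ (y - x) / (ρ * c * u * ρ) :=
        card_le_div_of_geometric_le hρ0 (by linarith) (by positivity) R
          (fun r hr => by have := hRL r hr; simp only [α] at this; linarith) (hS2.image _)
      have hb2 : (S2.card : ℝ) ≤
          ∑ r ∈ R, ((y - x) * ((C r).card / ((1 - ρ) * α r)) + 1) := by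
        have e : S2.card = ∑ r ∈ R, (S2.filter fun j => cls j.1 = r).card :=
          Finset.card_eq_sum_card_image _ _
        rw [e]
        push_cast
        refine Finset.sum_le_sum fun r hr => ?_
        refine card_staggered_le (w := ρ * α r) (hidx1 r) (hidx2 r)
          (mul_pos (by linarith) (hα r)) (mul_pos hρ0 (hα r)).le
          (by linarith [hRL r hr]) _ (fun j hj => ?_) (fun j hj => ?_)
        · obtain ⟨hj, hjr⟩ := Finset.mem_filter.1 hj
          simpa [C, hjr] using (Finset.mem_filter.1 hj).2
        · obtain ⟨hj', rfl⟩ := Finset.mem_filter.1 hj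
          obtain ⟨hjS, hjm⟩ := Finset.mem_filter.1 hj'
          have := hSxy j hjS
          simpa only [τ, φ, w, hjm, if_false] using this
      have hb3 : ∑ r ∈ R, ((C r).card : ℝ) / ((1 - ρ) * α r) ≤
          (1 + ρ) / (1 - ρ) * (n / (n + 1) * ∑ i with ¬ med i, 1 / a i) := by
        calc ∑ r ∈ R, ((C r).card : ℝ) / ((1 - ρ) * α r)
            = ∑ r ∈ R, ∑ i ∈ C r, 1 / ((1 - ρ) * α (cls i)) := by
              refine Finset.sum_congr rfl fun r _ => ?_
              rw [Finset.sum_congr rfl (g := fun _ => 1 / ((1 - ρ) * α r)), Finset.sum_const,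
                nsmul_eq_mul, mul_one_div]
              intro i hi
              simp only [C, Finset.mem_filter] at hi
              rw [hi.2.2]
          _ = ∑ i ∈ R.biUnion C, 1 / ((1 - ρ) * α (cls i)) := by
              rw [Finset.sum_biUnion]
              intro r _ r' _ hrr
              rw [Function.onFun, Finset.disjoint_left]
              intro i hi hi'
              simp only [C, Finset.mem_filter] at hi hi'
              exact hrr (hi.2.2.symm.trans hi'.2.2)
          _ ≤ ∑ i with ¬ med i, 1 / ((1 - ρ) * α (cls i)) := by
              refine Finset.sum_le_sum_of_subset_of_nonneg (fun i hi => ?_) fun i _ _ => ?_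
              · obtain ⟨r, -, hi⟩ := Finset.mem_biUnion.1 hi
                simp only [C, Finset.mem_filter] at hi
                simpa using hi.2.1
              · have := hα (cls i)
                have : 0 < 1 - ρ := by linarith
                positivity
          _ ≤ ∑ i with ¬ med i, (1 + ρ) / (1 - ρ) * (n / (n + 1) * (1 / a i)) := by
              refine Finset.sum_le_sum fun i hi => ?_
              have hi' := (hcls i (by simpa using hi)).2
              have h0 : 0 < 1 - ρ := by linarith
              have h0' := ha i
              rw [← hcn, div_mul_div_comm, mul_one,
                div_le_div_iff₀ (mul_pos h0 (hα _)) (by positivity)]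
              simp only [α]
              rw [pow_succ] at hi'
              have : (1 - ρ) * c * a i ≤ (1 - ρ) * c * (u * ((1 + ρ) ^ cls i * (1 + ρ))) := by
                gcongr
              linarith
          _ = _ := by rw [Finset.mul_sum, Finset.mul_sum]
      rw [Finset.sum_add_distrib, ← Finset.mul_sum, Finset.sum_const, nsmul_eq_mul,
        mul_one] at hb2
      have hsplit := Finset.sum_filter_add_sum_filter_not Finset.univ med fun i => 1 / a i
      have hnn1 : 0 ≤ ∑ i with med i, 1 / a i :=
        Finset.sum_nonneg fun i _ => by have := ha i; positivity
      -- The length of the shortest possible small window. The factor `16 n²` in the cutoff is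
      -- chosen to produce this value.
      have hw0 : ρ * c * u = 2 * (n + 1) * N := by
        rw [hρ, hc, hu]; field_simp; ring
      have hLw : 2 * (n + 1) * (N : ℝ) ≤ y - x := by
        obtain ⟨j, hj⟩ := hS2
        refine le_trans ?_ (hR j hj)
        rw [← hw0]
        simp only [α]
        have : 1 ≤ (1 + ρ) ^ cls j.1 := one_le_pow₀ (by linarith)
        calc ρ * c * u = ρ * c * u * 1 := by ring
          _ ≤ ρ * c * u * (1 + ρ) ^ cls j.1 := by gcongr
          _ = _ := by ring
      have hfin := demand_le_supply hn hN hp hmed (by linarith) (by linarith) hLw (h := h)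
      have hb3' : (y - x) * ∑ r ∈ R, ((C r).card : ℝ) / ((1 - ρ) * α r) ≤ (y - x) *
          ((1 + ρ) / (1 - ρ) * (n / (n + 1) * ∑ i with ¬ med i, 1 / a i)) :=
        mul_le_mul_of_nonneg_left hb3 (by linarith)
      rw [hw0] at hRcard
      have h9 := hF2 x y hxy
      have : (S.card : ℝ) ≤ (slots F x y).card := by
        rw [← hcard]; push_cast; linarith
      exact_mod_cast this)
  refine ⟨f, hf, fun j => (hf' j).2, fun i => ⟨τ i, w i, φ i, ?_, ?_, ?_, fun k => (hf' (i, k)).1⟩⟩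
  · have := ha i
    have := hα (cls i)
    have : 0 < 1 - ρ := by linarith
    simp only [τ]; split_ifs <;> positivity
  · have := ha i
    have := hα (cls i)
    simp only [w]; split_ifs <;> positivity
  · by_cases hi : med i
    · simp only [τ, w, hi, if_true]; linarith
    · simp only [τ, w, hi, if_false]
      have := mul_le_mul_of_nonneg_left (hcls i hi).1 hc0.le
      simp only [α]
      linarith

/-! ### Inserting a free slot before every `n` days -/

/-- When a slot is inserted at each multiple of `n + 1`, the number of the first original day that
does not come before time `t`. -/
def originalDay (n : ℕ) (t : ℤ) : ℤ := n * t / (n + 1)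

/-- The time of the original day `d` when a slot is inserted at each multiple of `n + 1`. -/
def stretchedTime (n : ℕ) (d : ℤ) : ℤ := d + d / n + 1

section

variable {n : ℕ}

/-- Both sides say `n * t < (d + 1) * (n + 1)`. This Galois connection replaces most of the floor
arithmetic that follows. -/
theorem originalDay_le_iff (hn : 1 ≤ n) {t d : ℤ} :
    originalDay n t ≤ d ↔ t ≤ stretchedTime n d := by
  have hn0 : (0 : ℤ) < n := by exact_mod_cast hn
  have h1 : stretchedTime n d = (d * n + d + n) / n := by
    rw [stretchedTime, show d * n + d + n = d + (d + 1) * n by ring,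
      Int.add_mul_ediv_right _ _ hn0.ne']
    ring
  rw [h1, Int.le_ediv_iff_mul_le hn0, originalDay, ← Int.lt_add_one_iff,
    Int.ediv_lt_iff_lt_mul (by omega), ← Int.lt_add_one_iff]
  constructor <;> intro h <;> linarith

theorem originalDay_stretchedTime (hn : 1 ≤ n) (d : ℤ) :
    originalDay n (stretchedTime n d) = d := by
  have hn0 : (0 : ℤ) < n := by exact_mod_cast hn
  refine le_antisymm ((originalDay_le_iff hn).2 le_rfl) ?_
  rw [originalDay, Int.le_ediv_iff_mul_le (by omega), stretchedTime]
  have h1 := Int.mul_ediv_add_emod d n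
  have h2 := Int.emod_lt_of_pos d hn0
  linarith

theorem not_dvd_stretchedTime (hn : 1 ≤ n) (d : ℤ) : ¬ ((n : ℤ) + 1) ∣ stretchedTime n d := by
  have hn0 : (0 : ℤ) < n := by exact_mod_cast hn
  have h1 := Int.mul_ediv_add_emod d n
  have h2 := Int.emod_lt_of_pos d hn0
  have h3 := Int.emod_nonneg d hn0.ne'
  intro h
  have e : stretchedTime n d = (n + 1) * (d / n) + (d % n + 1) := by
    rw [stretchedTime]; linarith
  rw [e] at h
  have h4 := (Int.dvd_add_right (Dvd.intro _ rfl)).1 h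
  have := Int.le_of_dvd (by omega) h4
  omega

theorem stretchedTime_originalDay (hn : 1 ≤ n) {t : ℤ} (ht : ¬ ((n : ℤ) + 1) ∣ t) :
    stretchedTime n (originalDay n t) = t := by
  have hn0 : (0 : ℤ) < n := by exact_mod_cast hn
  refine le_antisymm ?_ ((originalDay_le_iff hn).1 le_rfl)
  by_contra hcon
  have h1 := (originalDay_le_iff hn).2 (Int.add_one_le_iff.2 (not_le.1 hcon))
  have h2 : originalDay n t * (n + 1) ≤ n * t := Int.ediv_mul_le _ (by omega)
  rw [← Int.lt_add_one_iff, originalDay, Int.ediv_lt_iff_lt_mul (by omega)] at h1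
  have h3 : n * t = originalDay n t * (n + 1) := by linarith
  exact ht ⟨t - originalDay n t, by linarith⟩

theorem originalDay_mono {s t : ℤ} (h : s ≤ t) : originalDay n s ≤ originalDay n t := by
  unfold originalDay
  exact Int.ediv_le_ediv (by omega) (by gcongr)

theorem stretchedTime_injective (hn : 1 ≤ n) : Function.Injective (stretchedTime n) :=
  Function.LeftInverse.injective (originalDay_stretchedTime hn)

/-! ### Counting the free slots -/

theorem card_busy_le_of_periodic {w : List ℕ} (hw : w ≠ []) (d : ℤ) :
    ((Finset.Ico d (d + w.length)).filter fun s => letterAt w s ≠ 0).card ≤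
      w.length - w.count 0 := by
  have hp : (0 : ℤ) < w.length := by exact_mod_cast List.length_pos_iff.2 hw
  have h1 : ((Finset.range w.length).filter fun i => w.getD i 0 = 0).card = w.count 0 := by
    rw [← count_zero_map_range]
    congr 1
    refine List.ext_getElem (by simp) fun i h1 h2 => ?_
    simp [h2]
  have h2 := Finset.card_filter_add_card_filter_not (s := Finset.range w.length)
    fun i => w.getD i 0 = 0
  rw [h1, Finset.card_range] at h2
  have h3 : ((Finset.Ico d (d + w.length)).filter fun s => letterAt w s ≠ 0).card ≤
      ((Finset.range w.length).filter fun i => ¬ w.getD i 0 = 0).card := by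
    refine Finset.card_le_card_of_injOn (fun s => (s % w.length).toNat) ?_ ?_
    · intro s hs
      simp only [Finset.coe_filter, Finset.mem_Ico, Set.mem_ofPred_eq, Finset.mem_range] at hs ⊢
      have := Int.emod_lt_of_pos s hp
      exact ⟨by omega, hs.2⟩
    · intro s hs t ht hst
      simp only [Finset.coe_filter, Finset.mem_Ico, Set.mem_ofPred_eq] at hs ht hst
      have e1 := Int.emod_nonneg s hp.ne'
      have e2 := Int.emod_nonneg t hp.ne'
      have h4 : s % w.length = t % w.length := by omega
      obtain ⟨k, hk⟩ := Int.ModEq.dvd (show s ≡ t [ZMOD w.length] from h4)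
      have hk1 : k < 1 := by
        by_contra hcon
        have : (w.length : ℤ) * 1 ≤ w.length * k := by gcongr; omega
        omega
      have hk2 : -1 < k := by
        by_contra hcon
        have : (w.length : ℤ) * k ≤ w.length * (-1) := by gcongr; omega
        omega
      have : k = 0 := by omega
      subst this
      omega
  omega

/-- Full periods are exact and can be peeled off. In a rest of `M < p` days with `z` holidays per
period, at most `min M (p - z)` days are busy, which exceeds the average by at most `z * (p - z) / p
≤ p / 4`. -/
theorem card_busy_le {w : List ℕ} (hw : w ≠ []) (M : ℕ) (d : ℤ) :
    (((Finset.Ico d (d + M)).filter fun s => letterAt w s ≠ 0).card : ℝ) ≤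
      (1 - (w.count 0 : ℝ) / w.length) * M + w.length / 4 := by
  have hpos := List.length_pos_iff.2 hw
  have hp : (0 : ℝ) < w.length := by exact_mod_cast hpos
  have hz := List.count_le_length (a := 0) (l := w)
  have hz' : (w.count 0 : ℝ) ≤ w.length := by exact_mod_cast hz
  induction M using Nat.strong_induction_on generalizing d with
  | _ M ih =>
  have hP : (((Finset.Ico d (d + w.length)).filter fun s => letterAt w s ≠ 0).card : ℝ) ≤
      w.length - w.count 0 := by
    rw [← Nat.cast_sub hz]
    exact_mod_cast card_busy_le_of_periodic hw d
  rcases le_or_gt w.length M with hM | hM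
  · have h1 := ih (M - w.length) (by omega) (d + w.length)
    have e : (Finset.Ico d (d + M)).filter (fun s => letterAt w s ≠ 0) ⊆
        (Finset.Ico d (d + w.length)).filter (fun s => letterAt w s ≠ 0) ∪
        (Finset.Ico (d + w.length) (d + w.length + (M - w.length : ℕ))).filter
          (fun s => letterAt w s ≠ 0) := by
      intro s hs
      simp only [Finset.mem_union, Finset.mem_filter, Finset.mem_Ico] at hs ⊢
      rcases lt_or_ge s (d + w.length) with h | h
      · exact .inl ⟨⟨hs.1.1, h⟩, hs.2⟩
      · exact .inr ⟨⟨h, by omega⟩, hs.2⟩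
    have h2 := (Finset.card_le_card e).trans (Finset.card_union_le _ _)
    have h3 := (Nat.cast_le (α := ℝ)).2 h2
    push_cast [Nat.cast_sub hM] at h1 h3
    have h4 : (1 - (w.count 0 : ℝ) / w.length) * w.length = w.length - w.count 0 := by
      field_simp
    linarith
  · have hM' : (M : ℝ) ≤ w.length := by exact_mod_cast hM.le
    have hsub : (Finset.Ico d (d + M)).filter (fun s => letterAt w s ≠ 0) ⊆
        (Finset.Ico d (d + w.length)).filter fun s => letterAt w s ≠ 0 := by
      refine Finset.filter_subset_filter _ (Finset.Ico_subset_Ico_right ?_)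
      omega
    have h1 := ((Nat.cast_le (α := ℝ)).2 (Finset.card_le_card hsub)).trans hP
    have h2 : (((Finset.Ico d (d + M)).filter fun s => letterAt w s ≠ 0).card : ℝ) ≤ M := by
      have := Finset.card_filter_le (Finset.Ico d (d + M)) fun s => letterAt w s ≠ 0
      rw [Int.card_Ico] at this
      have h3 : (d + M - d).toNat = M := by omega
      rw [h3] at this
      exact_mod_cast this
    set b := (((Finset.Ico d (d + M)).filter fun s => letterAt w s ≠ 0).card : ℝ)
    set p : ℝ := (w.length : ℝ)
    set z : ℝ := (w.count 0 : ℝ)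
    have hM0 : (0 : ℝ) ≤ M := by positivity
    have hz0 : (0 : ℝ) ≤ z := by positivity
    have key : b * p ≤ (p - z) * M + p * p / 4 := by
      rcases le_total (M : ℝ) (p - z) with h | h
      · nlinarith [sq_nonneg (p - 2 * z)]
      · nlinarith [sq_nonneg (p - 2 * z)]
    have e : (1 - z / p) * M + p / 4 = ((p - z) * M + p * p / 4) / p := by field_simp
    rw [e, le_div_iff₀ hp]
    exact key

/-- The times that the big tasks leave free, after the insertion of a slot at each multiple of
`n + 1` into the periodic repetition of a word. -/
def IsFree (n : ℕ) (w : List ℕ) (t : ℤ) : Prop :=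
  ((n : ℤ) + 1) ∣ t ∨ letterAt w (originalDay n t) = 0

theorem floor_le_card_slots (n : ℕ) (w : List ℕ) (x y : ℝ) (hxy : x ≤ y) :
    ⌊(y - x) / (n + 1)⌋₊ ≤ (slots (IsFree n w) x y).card := by
  have hn : (0 : ℝ) < n + 1 := by positivity
  set q := ⌊(y - x) / ((n : ℝ) + 1)⌋₊
  have hq : (q : ℝ) * (n + 1) ≤ y - x := by
    rw [← le_div_iff₀ hn]
    exact Nat.floor_le (div_nonneg (by linarith) hn.le)
  set k0 := ⌈x / ((n : ℝ) + 1)⌉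
  have h1 : x ≤ k0 * (n + 1) := by rw [← div_le_iff₀ hn]; exact Int.le_ceil _
  have h2 : (k0 : ℝ) * (n + 1) < x + (n + 1) := by
    have := Int.ceil_lt_add_one (x / ((n : ℝ) + 1))
    have h3 : (k0 : ℝ) - 1 < x / (n + 1) := by linarith
    rw [lt_div_iff₀ hn] at h3
    linarith
  rw [← Finset.card_range q]
  refine Finset.card_le_card_of_injOn (fun i : ℕ => (k0 + i) * ((n : ℤ) + 1)) ?_ ?_
  · intro i hi
    have hi' : (i : ℝ) + 1 ≤ q := by exact_mod_cast Finset.mem_range.1 hi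
    have hi0 : (0 : ℝ) ≤ i * (n + 1) := by positivity
    have h4 : ((i : ℝ) + 1) * (n + 1) ≤ q * (n + 1) := by gcongr
    refine mem_slots.2 ⟨⟨?_, ?_⟩, .inl (Dvd.intro_left _ rfl)⟩
    · push_cast; linarith
    · push_cast; linarith
  · intro i _ j _ hij
    have := mul_right_cancel₀ (by positivity) hij
    omega

/-- The busy slots are counted instead: they correspond injectively to busy original days. The error
2 is one unit for rounding the endpoints and one for the possible extra original day. -/
theorem le_card_slots {n : ℕ} (hn : 1 ≤ n) {w : List ℕ} (hw : w ≠ []) (x y : ℝ) (hxy : x ≤ y) :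
    (y - x) * ((1 + (w.count 0 : ℝ) / w.length * n) / (n + 1)) - 2 - w.length / 4 ≤
      (slots (IsFree n w) x y).card := by
  classical
  set h : ℝ := (w.count 0 : ℝ) / w.length with hh
  have hp : (0 : ℝ) < w.length := by exact_mod_cast List.length_pos_iff.2 hw
  have hh0 : 0 ≤ h := by positivity
  have hh1 : h ≤ 1 := by
    rw [hh, div_le_one hp]
    exact_mod_cast List.count_le_length
  have hn' : (0 : ℝ) < n + 1 := by positivity
  set X := ⌈x⌉
  set Y := ⌈y⌉
  have hXY : X ≤ Y := Int.ceil_mono hxy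
  have h1 : (slots (IsFree n w) x y).card +
      ((Finset.Ico X Y).filter fun t => ¬ IsFree n w t).card = (Y - X).toNat := by
    rw [← Int.card_Ico]
    exact Finset.card_filter_add_card_filter_not (s := Finset.Ico X Y) (IsFree n w)
  have hc := originalDay_mono (n := n) hXY
  obtain ⟨M, hM⟩ : ∃ M : ℕ, originalDay n Y = originalDay n X + M :=
    ⟨(originalDay n Y - originalDay n X).toNat, by omega⟩
  have h2 : ((Finset.Ico X Y).filter fun t => ¬ IsFree n w t).card ≤
      ((Finset.Ico (originalDay n X) (originalDay n X + M)).filter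
        fun s => letterAt w s ≠ 0).card := by
    refine Finset.card_le_card_of_injOn (originalDay n) ?_ ?_
    · intro t ht
      simp only [Finset.coe_filter, Finset.mem_Ico, Set.mem_ofPred_eq, IsFree, not_or] at ht ⊢
      refine ⟨⟨originalDay_mono ht.1.1, ?_⟩, ht.2.2⟩
      rw [← hM]
      by_contra hcon
      have := (originalDay_le_iff hn).1 (not_lt.1 hcon)
      rw [stretchedTime_originalDay hn ht.2.1] at this
      omega
    · intro s hs t ht hst
      simp only [Finset.coe_filter, Finset.mem_Ico, Set.mem_ofPred_eq, IsFree, not_or] at hs ht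
      rw [← stretchedTime_originalDay hn hs.2.1, hst, stretchedTime_originalDay hn ht.2.1]
  have h3 := card_busy_le hw M (originalDay n X)
  have h4 : (M : ℝ) * (n + 1) ≤ n * (Y - X) + (n + 1) := by
    have g1 : originalDay n Y * (n + 1) ≤ n * Y := Int.ediv_mul_le _ (by omega)
    have g2 : n * X < (originalDay n X + 1) * (n + 1) := Int.lt_ediv_add_one_mul_self _ (by omega)
    have g3 : (M : ℤ) * (n + 1) ≤ n * (Y - X) + (n + 1) := by rw [hM] at g1; linarith
    exact_mod_cast g3
  have h5 : ((slots (IsFree n w) x y).card : ℝ) +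
      ((Finset.Ico X Y).filter fun t => ¬ IsFree n w t).card = Y - X := by
    have e : ((Y - X).toNat : ℝ) = ((Y - X : ℤ) : ℝ) := by
      exact_mod_cast Int.toNat_of_nonneg (by omega)
    rw [Int.cast_sub] at e
    rw [← e, ← h1]; push_cast; rfl
  have h6 := (Nat.cast_le (α := ℝ)).2 h2
  have h7 : y - x - 1 ≤ (Y : ℝ) - X := by
    have := Int.le_ceil y
    have := Int.ceil_lt_add_one x
    linarith
  have h8 : (1 - h) * M ≤ (1 - h) * (n * (Y - X) / (n + 1) + 1) := by
    refine mul_le_mul_of_nonneg_left ?_ (by linarith)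
    rw [div_add_one hn'.ne', le_div_iff₀ hn']
    exact h4
  have e : ((Y : ℝ) - X) - (1 - h) * (n * (Y - X) / (n + 1) + 1) =
      ((Y : ℝ) - X) * ((1 + h * n) / (n + 1)) - (1 - h) := by
    field_simp
    ring
  have hθ0 : 0 ≤ (1 + h * n) / (n + 1) := by positivity
  have hθ1 : (1 + h * n) / (n + 1) ≤ 1 := by
    rw [div_le_one hn']
    nlinarith [(Nat.cast_nonneg n : (0 : ℝ) ≤ n)]
  have h9 := mul_le_mul_of_nonneg_right h7 hθ0
  linarith

end

/-! ### Big tasks after stretching -/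

theorem floor_le_card_of_stretched {n : ℕ} (hn : 1 ≤ n) {a : ℕ} (ha : 1 ≤ a) {P Q : ℤ → Prop}
    [DecidablePred Q] (hP : ∀ d : ℤ, ∃ s, d ≤ s ∧ s < d + a ∧ P s)
    (hPQ : ∀ s, P s → Q (stretchedTime n s)) (t : ℤ) (L : ℕ) :
    ⌊(L : ℝ) / ((1 + 1 / n) * a)⌋₊ ≤ ((Finset.Ico t (t + L)).filter Q).card := by
  set q := ⌊(L : ℝ) / ((1 + 1 / n) * a)⌋₊
  have hn' : (0 : ℝ) < n := by exact_mod_cast hn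
  have ha' : (0 : ℝ) < a := by exact_mod_cast ha
  have hq : q * a * (n + 1) ≤ n * L := by
    have h1 : (q : ℝ) * ((1 + 1 / n) * a) ≤ L := by
      rw [← le_div_iff₀ (by positivity)]
      exact Nat.floor_le (by positivity)
    have h2 : (q : ℝ) * a * (n + 1) ≤ n * L := by
      calc (q : ℝ) * a * (n + 1) = n * (q * ((1 + 1 / n) * a)) := by field_simp
        _ ≤ _ := by gcongr
    exact_mod_cast h2
  -- The integer inequality `hq` lets `q` whole blocks of `a` original days fit into the interval,
  -- with nothing lost to the floors.
  have hend : originalDay n t + q * a ≤ originalDay n (t + L) := by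
    rw [originalDay, originalDay, Int.le_ediv_iff_mul_le (by omega)]
    have g1 : n * t / ((n : ℤ) + 1) * (n + 1) ≤ n * t := Int.ediv_mul_le _ (by omega)
    have g2 : (q : ℤ) * a * (n + 1) ≤ n * L := by exact_mod_cast hq
    linarith
  choose s hs1 hs2 hs3 using fun i : ℕ => hP (originalDay n t + i * a)
  rw [← Finset.card_range q]
  refine Finset.card_le_card_of_injOn (fun i => stretchedTime n (s i)) ?_ ?_
  · intro i hi
    have hi' : i + 1 ≤ q := Finset.mem_range.1 hi
    have hia : ((i : ℤ) + 1) * a ≤ q * a := by gcongr; exact_mod_cast hi'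
    have hi0 : (0 : ℤ) ≤ i * a := by positivity
    have := hs1 i
    have := hs2 i
    simp only [Finset.coe_filter, Finset.mem_Ico, Set.mem_ofPred_eq]
    refine ⟨⟨(originalDay_le_iff hn).1 (by linarith), ?_⟩, hPQ _ (hs3 i)⟩
    by_contra hcon
    have := (originalDay_le_iff hn).2 (not_lt.1 hcon)
    linarith
  · intro i _ j _ hij
    have h : s i = s j := stretchedTime_injective hn hij
    have h1 := hs1 i
    have h2 := hs2 i
    have h3 := hs1 j
    have h4 := hs2 j
    rcases lt_trichotomy i j with hlt | heq | hgt
    · have : ((i : ℤ) + 1) * a ≤ j * a := by gcongr; exact_mod_cast hlt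
      linarith
    · exact heq
    · have : ((j : ℤ) + 1) * a ≤ i * a := by gcongr; exact_mod_cast hgt
      linarith

/-! ### The answer "schedulable" -/

theorem Schedulable.mono {ι : Type*} [DecidableEq ι] {a b : ι → ℝ} (ha : ∀ i, 0 < a i)
    (hab : ∀ i, a i ≤ b i) (h : Schedulable a) : Schedulable b := by
  obtain ⟨σ, hσ⟩ := h
  refine ⟨σ, fun i t L => le_trans (Nat.floor_le_floor ?_) (hσ i t L)⟩
  exact div_le_div_of_nonneg_left (by positivity) (ha i) (hab i)

theorem schedulable_of_assignment {m : ℕ} {A : Fin m → ℕ} (hA : ∀ i, 1 ≤ A i) {n l : ℕ}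
    (hn : 1 ≤ n) {w : List ℕ} (hw : w ≠ [])
    (hv : (allValid w 1 ((List.ofFn A).filter fun j => j ≤ l)).val = true)
    {f : {i // l < A i} × ℤ → ℤ} (hf : Function.Injective f) (hfree : ∀ j, IsFree n w (f j))
    (hfw : ∀ i, ∃ τ w φ : ℝ, 0 < τ ∧ 0 < w ∧ τ + w ≤ (1 + 1 / n) * A i.1 ∧
      ∀ k : ℤ, k * τ + φ ≤ f (i, k) ∧ (f (i, k) : ℝ) < k * τ + φ + w) :
    Schedulable fun i => (1 + 1 / (n : ℝ)) * A i := by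
  classical
  let I := tasksWhere A (· ≤ l)
  have hI : (List.ofFn A).filter (fun j => j ≤ l) = I.map A := filter_ofFn A (· ≤ l)
  rw [hI] at hv
  let σ : Schedule (Fin m) := fun t =>
    if IsFree n w t then
      if h : ∃ j, f j = t then some h.choose.1.1 else none
    -- Letter `c + 1` is task `c`. Letter 0 never gets here, because it makes the slot free; letters
    -- beyond the list give a holiday.
    else I[letterAt w (originalDay n t) - 1]?
  have hσ1 : ∀ j, σ (f j) = some j.1.1 := by
    intro j
    have h : ∃ j', f j' = f j := ⟨j, rfl⟩
    simp only [σ, hfree j, if_true, dif_pos h]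
    rw [hf h.choose_spec]
  have hσ2 : ∀ i (hi : i ∈ I) s, letterAt w s = I.idxOf i + 1 →
      σ (stretchedTime n s) = some i := by
    intro i hi s hs
    have hnf : ¬ IsFree n w (stretchedTime n s) := by
      rw [IsFree, originalDay_stretchedTime hn, hs]
      simpa using not_dvd_stretchedTime hn s
    simp only [σ, hnf, if_false, originalDay_stretchedTime hn, hs, Nat.add_sub_cancel]
    simp [List.getElem?_idxOf hi]
  refine ⟨σ, fun i t L => ?_⟩
  rcases le_or_gt (A i) l with hi | hi
  · have hiI : i ∈ I := mem_tasksWhere.2 hi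
    have hidx := List.idxOf_lt_length_iff.2 hiI
    have hval := (allValid_iff _ _ _).1 hv (I.idxOf i) (by simpa using hidx)
    rw [List.getElem_map, List.getElem_idxOf] at hval
    refine floor_le_card_of_stretched hn (hA i) (P := fun s => letterAt w s = I.idxOf i + 1)
      (Q := fun s => σ s = some i) (fun d => ?_) (fun s hs => hσ2 i hiI s hs) t L
    obtain ⟨s, h1, h2, h3⟩ := exists_letterAt_eq (hA i) hw hval d
    exact ⟨s, h1, h2, by rw [h3, add_comm]⟩
  · obtain ⟨τ, w', φ, hτ, hw', hb, hk⟩ := hfw ⟨i, hi⟩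
    exact floor_le_card_of_windows hτ hw' hb (f := fun k => f (⟨i, hi⟩, k))
      (fun k k' h => by simpa using hf h) hk (fun s => σ s = some i) (fun k => hσ1 _) t L

theorem sixty_four_mul_le_pow_self {n l : ℕ} (hn : 4 ≤ n) (hl : n ≤ l) : 64 * n ≤ l ^ l := by
  have h4 : 4 ≤ l := hn.trans hl
  calc 64 * n = 4 ^ 3 * n := by norm_num
    _ ≤ l ^ 3 * l := by gcongr
    _ = l ^ 4 := by ring
    _ ≤ l ^ l := Nat.pow_le_pow_right (by omega) h4

theorem schedulable_of_allValid {m : ℕ} {A : Fin m → ℕ} (hA : ∀ i, 1 ≤ A i) {n l : ℕ}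
    (hn : 4 ≤ n) (hl : n ≤ l) {w : List ℕ} (hw : w ≠ []) (hwl : w.length ≤ l ^ l)
    (hv : (allValid w 1 ((List.ofFn A).filter fun j => j ≤ l)).val = true)
    (hD : recipSum (List.ofFn A) ≤ 1)
    (hmed : recipSum ((List.ofFn A).filter fun j => l < j ∧ j < 16 * n ^ 2 * l ^ l) ≤
      1 / (2 * (n + 1)))
    (hnot : recipSum ((List.ofFn A).filter fun j => l < j) ≤ (w.count 0 : ℚ) / w.length) :
    Schedulable fun i => (1 + 1 / (n : ℝ)) * A i := by
  have hA0 : ∀ i, (0 : ℝ) < A i := fun i => by exact_mod_cast hA i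
  have hsum1 := (recipSum_filter_le (List.ofFn A) fun j => l < j).trans hD
  rw [recipSum_filter_ofFn] at hsum1 hnot
  rw [recipSum_filter_ofFn A (fun j => l < j ∧ j < 16 * n ^ 2 * l ^ l)] at hmed
  have hsub : ∀ g : Fin m → ℝ, ∑ i with l < A i, g i = ∑ i : {i // l < A i}, g i.1 := fun g =>
    Finset.sum_subtype _ (by simp) g
  have hnot' : ∑ i : {i // l < A i}, 1 / (A i.1 : ℝ) ≤ (w.count 0 : ℝ) / w.length := by
    rw [← hsub fun i => 1 / (A i : ℝ)]
    simpa using (Rat.cast_le (K := ℝ)).2 hnot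
  have hsum1' : ∑ i : {i // l < A i}, 1 / (A i.1 : ℝ) ≤ 1 := by
    rw [← hsub fun i => 1 / (A i : ℝ)]
    simpa using (Rat.cast_le (K := ℝ)).2 hsum1
  have hmed' : ∑ i : {i // l < A i} with A i.1 < 16 * n ^ 2 * l ^ l, 1 / (A i.1 : ℝ) ≤
      1 / (2 * (n + 1)) := by
    rw [Finset.sum_filter,
      ← hsub fun i => if A i < 16 * n ^ 2 * l ^ l then 1 / (A i : ℝ) else 0,
      ← Finset.sum_filter, Finset.filter_filter]
    simpa using (Rat.cast_le (K := ℝ)).2 hmed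
  obtain ⟨f, hf, hfree, hfw⟩ := exists_assignment_of_density hn
    (sixty_four_mul_le_pow_self hn hl) hwl (floor_le_card_slots n w)
    (le_card_slots (by omega) hw) (a := fun i : {i // l < A i} => (A i.1 : ℝ))
    (fun i => hA0 i.1) (fun i => A i.1 < 16 * n ^ 2 * l ^ l) hmed'
    (fun i hi => by exact_mod_cast not_lt.1 hi) hnot' hsum1'
  exact schedulable_of_assignment hA (by omega) hw hv hf hfree hfw

/-! ### The approximation scheme -/

theorem pinwheelPTAS_of_dense {ε : ℝ} {A : List ℕ} (h : 1 < recipSum A) :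
    (pinwheelPTAS ε A).val = .unschedulable ∧ (pinwheelPTAS ε A).steps = 3 * A.length + 6 := by
  simp [pinwheelPTAS, val_density, steps_density, h]
  ring

theorem pinwheelPTAS_of_not_dense {ε : ℝ} {A : List ℕ} (h : ¬ 1 < recipSum A) {n l : ℕ}
    {B C : List ℕ} {P : Timed ℚ} (hn : n = ⌈1 / ε⌉₊)
    (hl : l = (cutoffLoop A n n (16 * n ^ 2 * n ^ n)).val)
    (hB : B = A.filter fun j => j ≤ l) (hC : C = A.filter fun j => l < j)
    (hP : P = periodLoop B (B.length + 1) (l ^ l) 1 (-1)) :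
    (pinwheelPTAS ε A).val =
        (if P.val < recipSum C then .unschedulable else .scaledSchedulable) ∧
      (pinwheelPTAS ε A).steps ≤ (cutoffLoop A n n (16 * n ^ 2 * n ^ n)).steps + P.steps +
        2 * n + 2 * l + 14 * A.length + 30 := by
  have s1 := steps_select_le (fun j => op (decide (j ≤ l))) 1 (by simp) A
  have s2 := steps_select_le (fun j => op (decide (l < j))) 1 (by simp) A
  have l1 : B.length ≤ A.length := hB ▸ List.length_filter_le _ _
  have l2 : C.length ≤ A.length := hC ▸ List.length_filter_le _ _
  subst hl
  constructor
  · simp only [pinwheelPTAS, Timed.val_bind, val_op, val_density, h, decide_false,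
      Bool.false_eq_true, if_false, val_nextCutoff, val_select, ← hB, ← hC, ← hP, val_len,
      val_power, ← hn, decide_eq_true_eq]
    split_ifs <;> rfl
  · by_cases hlast : P.val < recipSum C
    · simp only [pinwheelPTAS, Timed.steps_bind, steps_op, val_op, val_density,
        steps_density, h, decide_false, Bool.false_eq_true, if_false, val_nextCutoff,
        steps_nextCutoff, val_select, ← hB, ← hC, ← hP, val_len, steps_len, val_power, steps_power,
        ← hn, steps_call, Timed.steps_pure, hlast, decide_true, if_true]
      omega
    · simp only [pinwheelPTAS, Timed.steps_bind, steps_op, val_op, val_density,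
        steps_density, h, decide_false, Bool.false_eq_true, if_false, val_nextCutoff,
        steps_nextCutoff, val_select, ← hB, ← hC, ← hP, val_len, steps_len, val_power, steps_power,
        ← hn, steps_call, Timed.steps_pure, hlast]
      omega

/-! ### Size of the running time -/

theorem periodLoop_cost_le {N b : ℕ} (hN : 256 ≤ N) (hb : b + 1 ≤ N) :
    N * (3 + (N + 1) * ((b + 1) ^ N * (3 * (b + 1) + 5)) +
      (b + 1) ^ N * ((7 * N + 5) * b + 3 * N + 6)) + 1 ≤ N ^ (N + 4) := by
  have hX : 1 ≤ N ^ N := Nat.one_le_pow _ _ (by omega)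
  have h2 : 10 * N ^ 2 + 16 * N + 15 ≤ N ^ 3 := by nlinarith [mul_le_mul hN hN (by omega) (by omega)]
  calc _ ≤ N * (3 + (N + 1) * (N ^ N * (3 * N + 5)) +
        N ^ N * ((7 * N + 5) * N + 3 * N + 6)) + 1 := by gcongr; omega
    _ ≤ N * (N ^ N * 3 + (N + 1) * (N ^ N * (3 * N + 5)) +
        N ^ N * ((7 * N + 5) * N + 3 * N + 6)) + N * N ^ N := by
      gcongr
      · omega
      · nlinarith
    _ = N * N ^ N * (10 * N ^ 2 + 16 * N + 15) := by ring
    _ ≤ N * N ^ N * N ^ 3 := by gcongr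
    _ = N ^ (N + 4) := by ring

theorem sq_le_two_pow {x : ℕ} (hx : 4 ≤ x) : x ^ 2 ≤ 2 ^ x := by
  induction x, hx using Nat.le_induction with
  | base => norm_num
  | succ k hk ih => rw [pow_succ 2]; nlinarith

theorem total_cost_le {n l m T T' P c : ℕ} (hn : 7 * n + 12 < T)
    (hc : c ≤ (2 * (n + 1) + 1) * (8 * m + 17 + 2 * T')) (hP : P ≤ T) (hl : l ≤ T') (hT : T' ≤ T) :
    c + P + 2 * n + 2 * l + 14 * m + 30 ≤ 200 * T ^ 2 * (m + 1) := by
  have h1 : m ≤ T * m := Nat.le_mul_of_pos_left m (by omega)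
  have h2 : (2 * (n + 1) + 1) * (8 * m + 17 + 2 * T') ≤ 2 * T * (19 * (T * (m + 1))) := by
    refine Nat.mul_le_mul (by omega) ?_
    rw [mul_add]
    omega
  have h3 : P + 2 * n + 2 * l + 14 * m + 30 ≤ 100 * (T * (m + 1)) := by
    rw [mul_add]
    omega
  have h4 : T * (m + 1) ≤ T * (T * (m + 1)) := Nat.le_mul_of_pos_left _ (by omega)
  have e1 : 2 * T * (19 * (T * (m + 1))) = 38 * (T * (T * (m + 1))) := by ring
  have e2 : 200 * T ^ 2 * (m + 1) = 200 * (T * (T * (m + 1))) := by ring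
  omega

theorem four_le_ceil_one_div {ε : ℝ} (h0 : 0 < ε) (h1 : ε < 2 / 7) : 4 ≤ ⌈1 / ε⌉₊ := by
  have : (3 : ℝ) < 1 / ε := by
    rw [lt_div_iff₀ h0]; linarith
  have : 3 < ⌈1 / ε⌉₊ := Nat.lt_ceil.2 (by exact_mod_cast this)
  omega

theorem pinwheelPTAS_spec {ε : ℝ} (h0 : 0 < ε) (h1 : ε < 2 / 7) {m : ℕ} {A : Fin m → ℕ}
    (hA : ∀ i, 1 ≤ A i) :
    ((pinwheelPTAS ε (List.ofFn A)).val = Verdict.unschedulable →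
      ¬ Schedulable (fun i => (A i : ℝ))) ∧
    ((pinwheelPTAS ε (List.ofFn A)).val = Verdict.scaledSchedulable →
      Schedulable (fun i => (1 + ε) * (A i : ℝ))) ∧
    (pinwheelPTAS ε (List.ofFn A)).steps ≤
      200 * tower (7 * ⌈1 / ε⌉₊ + 13) * (m + 1) := by
  set n := ⌈1 / ε⌉₊ with hn
  have hn4 : 4 ≤ n := four_le_ceil_one_div h0 h1
  have hT : ∀ k, 1 ≤ tower k := fun k => Nat.one_le_of_lt (lt_tower k)
  by_cases hD : 1 < recipSum (List.ofFn A)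
  · obtain ⟨g1, g2⟩ := pinwheelPTAS_of_dense (ε := ε) hD
    refine ⟨fun _ hs => ?_, fun h => ?_, ?_⟩
    · exact absurd (recipSum_le_one_of_schedulable hA hs) (not_le.2 hD)
    · rw [g1] at h; cases h
    · rw [g2, List.length_ofFn]
      calc 3 * m + 6 ≤ 200 * 1 * (m + 1) := by omega
        _ ≤ _ := by gcongr; exact hT _
  · obtain ⟨l, hl⟩ : ∃ l, l = (cutoffLoop (List.ofFn A) n n (16 * n ^ 2 * n ^ n)).val := ⟨_, rfl⟩
    obtain ⟨B, hB⟩ : ∃ B, B = (List.ofFn A).filter fun j => j ≤ l := ⟨_, rfl⟩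
    obtain ⟨P, hP⟩ : ∃ P, P = periodLoop B (B.length + 1) (l ^ l) 1 (-1) := ⟨_, rfl⟩
    obtain ⟨g1, g2⟩ := pinwheelPTAS_of_not_dense hD hn hl hB rfl hP
    have hD' := not_lt.1 hD
    -- Density at most 1 is a budget of `2 * (n + 1)` thresholds, and the initial cutoff `n` lies
    -- below tower height `n`; hence the height `n + 3 * (2 * (n + 1))`.
    obtain ⟨c1, c2, c3, c4⟩ := cutoffLoop_spec hn4 (2 * (n + 1)) le_rfl (lt_tower n).le
      (A := List.ofFn A) (by
        refine ((recipSum_filter_le _ _).trans hD').trans (le_of_eq ?_)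
        push_cast
        rw [div_self (by positivity)]) hl
    rw [show n + 3 * (2 * (n + 1)) = 7 * n + 6 by ring] at c2 c4
    have hN := sixty_four_mul_le_pow_self hn4 c1
    have hkl : B.length ≤ l := by
      rw [hB]
      exact length_filter_le_of_recipSum_le_one (by simpa [List.mem_ofFn] using hA) hD' l
    have hPle := le_periodLoop_iff B (B.length + 1) (by omega) (l ^ l) 1 (-1)
    rw [← hP] at hPle
    refine ⟨fun h hs => ?_, fun h => ?_, ?_⟩
    · have := le_periodLoop_of_schedulable hA hs (l := l) (by omega) hB
      rw [← hP] at this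
      rw [g1, if_neg (not_lt.2 this)] at h
      cases h
    · have hle : recipSum ((List.ofFn A).filter fun j => l < j) ≤ P.val := by
        by_contra hcon
        rw [g1, if_pos (not_le.1 hcon)] at h
        cases h
      -- The sentinel `-1` is below every density, so passing the test yields an actual valid word.
      rcases (hPle _).1 hle with hneg | ⟨w, hw1, hw2, -, hwv, hwx⟩
      · have := recipSum_nonneg ((List.ofFn A).filter fun j => l < j)
        linarith
      · have hsch := schedulable_of_allValid hA hn4 c1 (List.length_pos_iff.1 hw1)
          (by omega) (hB ▸ hwv) hD' c3 hwx
        refine hsch.mono (fun i => ?_) (fun i => ?_)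
        · have := hA i
          positivity
        · have : (1 : ℝ) / n ≤ ε := by
            rw [div_le_iff₀ (by positivity)]
            have := Nat.le_ceil (1 / ε)
            rw [← hn, div_le_iff₀ h0] at this
            linarith
          gcongr
    · have hl4 : 4 ≤ l := hn4.trans c1
      have hP1 := steps_periodLoop_le B (B.length + 1) (by omega) (l ^ l) (l ^ l) 1 (-1) (by omega)
      rw [← hP] at hP1
      have hlN : l + 1 ≤ l ^ l := by
        calc l + 1 ≤ l ^ 2 := by nlinarith
          _ ≤ l ^ l := Nat.pow_le_pow_right (by omega) (by omega)
      have hP2 := hP1.trans (periodLoop_cost_le (by omega) (by omega))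
      have hNT : l ^ l ≤ tower (7 * n + 9) :=
        (Nat.pow_le_pow_right (by omega) (by omega)).trans (pow_add_four_le_tower hl4 c2)
      have hP3 := hP2.trans (pow_add_four_le_tower (by omega) hNT)
      have hTT : tower (7 * n + 6) ≤ tower (7 * n + 12) := tower_strictMono.monotone (by omega)
      rw [List.length_ofFn] at g2 c4
      rw [show 7 * n + 9 + 3 = 7 * n + 12 by ring] at hP3
      have hT4 : 7 * n + 12 < tower (7 * n + 12) := lt_tower _
      -- The cutoff lies below height `7 * n + 6`, `l ^ l` below `7 * n + 9` and the enumeration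
      -- below `7 * n + 12`. One more level absorbs the square in `total_cost_le`.
      refine (g2.trans ?_).trans (Nat.mul_le_mul_right (m + 1) (Nat.mul_le_mul_left 200
        (sq_le_two_pow (show 4 ≤ tower (7 * n + 12) by omega))))
      exact total_cost_le (by omega) c4 hP3 c2 hTT

theorem mainTheorem1 :
    ∃ K : ℕ,
      (∀ ε : ℝ, 0 < ε → ε < 2 / 7 →
        SolvesApproxPinwheel (1 + ε) (pinwheelPTAS ε)
          (fun m => K * tower (K * ⌈1 / ε⌉₊) * (m + 1))) ∧
      (∀ ε : ℝ, 2 / 7 ≤ ε →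
        SolvesApproxPinwheel (1 + ε) (pinwheelPTAS (1 / 4))
          (fun m => K * (m + 1))) := by
  have hex : ∀ t : ℕ, ∃ K, 200 ≤ K ∧ 200 * t ≤ K := fun t => ⟨200 + 200 * t, by omega, by omega⟩
  -- `K` dominates both the factor 200 and the fixed tower at parameter `1 / 4`. Part (b) runs that
  -- parameter because `1 / 4 ≤ 2 / 7 ≤ ε`.
  obtain ⟨K, hK1, hK2⟩ := hex (tower (7 * ⌈1 / (1 / 4 : ℝ)⌉₊ + 13))
  refine ⟨K, fun ε h0 h1 m A hA => ?_, fun ε h1 m A hA => ?_⟩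
  · obtain ⟨g1, g2, g3⟩ := pinwheelPTAS_spec h0 h1 hA
    have hn4 := four_le_ceil_one_div h0 h1
    refine ⟨g1, g2, g3.trans ?_⟩
    have : tower (7 * ⌈1 / ε⌉₊ + 13) ≤ tower (K * ⌈1 / ε⌉₊) :=
      tower_strictMono.monotone
        ((show 7 * ⌈1 / ε⌉₊ + 13 ≤ 200 * ⌈1 / ε⌉₊ by omega).trans (Nat.mul_le_mul_right _ hK1))
    exact Nat.mul_le_mul_right _ (Nat.mul_le_mul hK1 this)
  · obtain ⟨g1, g2, g3⟩ := pinwheelPTAS_spec (ε := 1 / 4) (by norm_num) (by norm_num) hA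
    refine ⟨g1, fun h => ?_, g3.trans ?_⟩
    · refine (g2 h).mono (fun i => ?_) (fun i => ?_)
      · have := hA i
        positivity
      · gcongr
        linarith
    · exact Nat.mul_le_mul_right _ hK2
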